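/- **Lemma (Equivalence of torus and qubit Hamiltonians).** *Definitions.* For a self-adjoint operator $h$ with domain $\mathcal D(h)$ on a Hilbert space, the energy of a nonzero $\psi\in\mathcal D(h)$ is $h[\psi]:=\langle\psi|h\psi\rangle/\langle\psi|\psi\rangle$. A subspace $\widetilde{\mathcal D}$ is an $(E,\epsilon)$-truncated domain of $h$ if for every normalized $\psi\in\mathcal D(h)$ with $h[\psi]\le E$ there is a normalized $\widetilde\psi\in\widetilde{\mathcal D}\cap\mathcal D(h)$ with $h[\widetilde\psi]\le h[\psi]+\epsilon$ and $\|\widetilde\psi-\psi\|\le\epsilon$. Self-adjoint operators $h_a,h_b$ are $(E,\epsilon)$-equivalent if they have $(E,\epsilon)$-truncated domains $\widetilde{\mathcal D}_a\subset\mathcal D(h_a)$ and $\widetilde{\mathcal D}_b\subset\mathcal D(h_b)$ and a unitary $U:\widetilde{\mathcal D}_a\to\widetilde{\mathcal D}_b$ with $|h_a[\psi]-h_b[U\psi]|\le\epsilon$ for all nonzero $\psi\in\widetilde{\mathcal D}_a$. Let $n\ge1$, $L\ge1$, $\mathbb T^n:=\mathbb R^n/L\mathbb Z^n$. The smoothness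 factor of a smooth $g:\mathbb T^n\to\mathbb R$ is $$\log_\partial(g,\mathbb T^n,m):=\max_{1\le l\le m,\ 1\le j\le n,\ x\in\mathbb T^n}\frac{\max(\log|\partial_j^l g(x)|,0)}{l}\qquad(m\ge1).$$ For $N$ a power of two let $\mathcal N:=\{-N/2,\dots,N/2-1\}$, and on $\mathbb C^{\mathcal N^n}$ with orthonormal basis $(|y\rangle)_{y\in\mathcal N^n}$ put $$K_Q:=\sum_{k\in\mathcal N^n}U_{\mathcal F}|k\rangle\,\frac{4\pi^2\|k\|_2^2}{L^2}\,\langle k|U_{\mathcal F}^\dagger,\qquad U_{\mathcal F}|k\rangle:=N^{-n/2}\sum_{y\in\mathcal N^n}e^{2\pi i k\cdot y/N}|y\rangle,\qquad V_Q:=\sum_{y\in\mathcal N^n}|y\rangle\,V\!\left(\tfrac{yL}{N}\right)\langle y|.$$ *Statement.* There is a universal constant $C>0$ such that the following holds for all $n\ge1$ and $L\ge1$. Let $V:\mathbb T^n\to\mathbb R$ be smooth with values in $[0,V_{\max}]$, and let $p$ be a real polynomial such that $p(m)>0$ and $\log_\partial(V,\mathbb T^n,m)\le\log p(m)$ for all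 integers $m\ge1$. Let $0<\epsilon<1$, let $E\in\mathbb R$ satisfy $E+V_{\max}\ge1$, and let $N$ be a power of two with $$N\ \ge\ C\,\frac{L^2\,p(2n)^2\,(E+V_{\max})^{3/2}}{\epsilon}.$$ Then $h_{\mathbb T^n}:=-\Delta+V$ on $L^2(\mathbb T^n)$, with domain $H^2(\mathbb T^n)$, and $h_Q:=K_Q+V_Q$ on $\mathbb C^{\mathcal N^n}$ are self-adjoint and $(E,\epsilon)$-equivalent. -/

import Mathlib

open MeasureTheory
open scoped ContDiff InnerProductSpace

noncomputable section

/-! ### Truncated domains and equivalence of (unbounded) self-adjoint operators -/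

/-- The energy (Rayleigh quotient) `h[ψ] = ⟨ψ | h ψ⟩ / ⟨ψ | ψ⟩` of `ψ ∈ D(h)`.  (It is real when `h`
is symmetric; the real part is taken in order to have a real number by definition.) -/
def energy {H : Type*} [NormedAddCommGroup H] [InnerProductSpace ℂ H]
    (h : H →ₗ.[ℂ] H) (ψ : h.domain) : ℝ :=
  (⟪(ψ : H), h ψ⟫_ℂ).re / ‖(ψ : H)‖ ^ 2

/-- `ψ'` is an `ε`-truncation of `ψ` with respect to `h`. -/
def IsTruncation {H : Type*} [NormedAddCommGroup H] [InnerProductSpace ℂ H]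
    (h : H →ₗ.[ℂ] H) (ε : ℝ) (ψ' ψ : h.domain) : Prop :=
  ‖(ψ' : H)‖ = 1 ∧ energy h ψ' ≤ energy h ψ + ε ∧ ‖(ψ' : H) - ψ‖ ≤ ε

/-- The subspace `D` is an `(E, ε)`-truncated domain of `h`. -/
def IsTruncatedDomain {H : Type*} [NormedAddCommGroup H] [InnerProductSpace ℂ H]
    (h : H →ₗ.[ℂ] H) (E ε : ℝ) (D : Submodule ℂ H) : Prop :=
  ∀ ψ : h.domain, ‖(ψ : H)‖ = 1 → energy h ψ ≤ E →
    ∃ ψ' : h.domain, (ψ' : H) ∈ D ∧ IsTruncation h ε ψ' ψ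

/-- `(E, ε)`-equivalence of two operators: both are self-adjoint, and they have `(E, ε)`-truncated
domains (on which the operators are defined, so that the energies make sense) that are identified
by a unitary which preserves the energy up to `ε`. -/
def EquivalentUpTo {Ha Hb : Type*}
    [NormedAddCommGroup Ha] [InnerProductSpace ℂ Ha] [CompleteSpace Ha]
    [NormedAddCommGroup Hb] [InnerProductSpace ℂ Hb] [CompleteSpace Hb]
    (ha : Ha →ₗ.[ℂ] Ha) (hb : Hb →ₗ.[ℂ] Hb) (E ε : ℝ) : Prop :=
  IsSelfAdjoint ha ∧ IsSelfAdjoint hb ∧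
  ∃ (Da : Submodule ℂ Ha) (Db : Submodule ℂ Hb) (hDa : Da ≤ ha.domain) (hDb : Db ≤ hb.domain)
    (U : Da ≃ₗᵢ[ℂ] Db),
    IsTruncatedDomain ha E ε Da ∧ IsTruncatedDomain hb E ε Db ∧
    ∀ ψ : Da, ψ ≠ 0 →
      |energy ha ⟨ψ, hDa ψ.2⟩ - energy hb ⟨U ψ, hDb (U ψ).2⟩| ≤ ε

/-! ### Smooth functions on the torus `ℝⁿ / L ℤⁿ` -/

/-- The torus `𝕋ⁿ = ℝⁿ / L ℤⁿ`. -/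
abbrev Torus (n : ℕ) (L : ℝ) : Type := Fin n → AddCircle L

/-- The projection `ℝⁿ → 𝕋ⁿ`. -/
def Torus.mk {n : ℕ} (L : ℝ) (ξ : Fin n → ℝ) : Torus n L := fun i => (ξ i : AddCircle L)

/-- A function on the torus is smooth if its periodic lift to `ℝⁿ` is. -/
def TorusSmooth {n : ℕ} {L : ℝ} {F : Type*} [NormedAddCommGroup F] [NormedSpace ℝ F]
    (f : Torus n L → F) : Prop :=
  ContDiff ℝ ∞ (fun ξ : Fin n → ℝ => f (Torus.mk L ξ))

/-- The pure partial derivative `∂ⱼˡ f (x)`: the `l`-th derivative of `t ↦ f (x + t eⱼ)` at `0`. -/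
def partialDeriv {n : ℕ} {L : ℝ} {F : Type*} [NormedAddCommGroup F] [NormedSpace ℝ F]
    (l : ℕ) (j : Fin n) (f : Torus n L → F) (x : Torus n L) : F :=
  iteratedDeriv l (fun t : ℝ => f (x + Pi.single j (t : AddCircle L))) 0

/-- The classical Laplacian `Δ f = ∑ⱼ ∂ⱼ² f`. -/
def torusLaplacian {n : ℕ} {L : ℝ} {F : Type*} [NormedAddCommGroup F] [NormedSpace ℝ F]
    (f : Torus n L → F) (x : Torus n L) : F :=
  ∑ j, partialDeriv 2 j f x

/-- The smoothness factor
`log_∂ (g, 𝕋ⁿ, m) = max { (log |∂ⱼˡ g (x)|)⁺ / l : 1 ≤ l ≤ m, 1 ≤ j ≤ n, x ∈ 𝕋ⁿ }`. -/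
def smoothnessFactor {n : ℕ} {L : ℝ} (g : Torus n L → ℝ) (m : ℕ) : ℝ :=
  sSup {r : ℝ | ∃ l ∈ Finset.Icc 1 m, ∃ (j : Fin n) (x : Torus n L),
    r = Real.posLog |partialDeriv l j g x| / l}

theorem isOpenQuotientMap_torusMk {n : ℕ} (L : ℝ) :
    IsOpenQuotientMap (Torus.mk (n := n) L) :=
  IsOpenQuotientMap.piMap (fun _ => QuotientAddGroup.isOpenQuotientMap_mk)

theorem continuous_of_torusSmooth {n : ℕ} {L : ℝ} {F : Type*} [NormedAddCommGroup F]
    [NormedSpace ℝ F] {f : Torus n L → F} (hf : TorusSmooth f) : Continuous f :=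
  (isOpenQuotientMap_torusMk L).continuous_comp_iff.1 (ContDiff.continuous hf)

theorem exists_iteratedDeriv_line {n : ℕ} {F : Type*} [NormedAddCommGroup F] [NormedSpace ℝ F]
    (j : Fin n) (l : ℕ) : ∀ f : (Fin n → ℝ) → F, ContDiff ℝ ∞ f →
      ∃ g : (Fin n → ℝ) → F, ContDiff ℝ ∞ g ∧ ∀ (ξ : Fin n → ℝ) (t : ℝ),
        iteratedDeriv l (fun s : ℝ => f (ξ + Pi.single j s)) t = g (ξ + Pi.single j t) := by
  induction l with
  | zero => exact fun f hf => ⟨f, hf, fun ξ t => by simp⟩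
  | succ l ih =>
    intro f hf
    have h1 : ContDiff ℝ ∞ (fun ξ => fderiv ℝ f ξ (Pi.single j 1)) :=
      (hf.fderiv_right (m := ∞) (by norm_cast)).clm_apply contDiff_const
    obtain ⟨g, hg, hg'⟩ := ih _ h1
    refine ⟨g, hg, fun ξ t => ?_⟩
    rw [iteratedDeriv_succ', ← hg']
    congr 1
    funext s
    have h2 : HasDerivAt (fun s : ℝ => ξ + Pi.single j s) (Pi.single j 1) s := by
      rw [hasDerivAt_pi]
      intro i
      rcases eq_or_ne i j with rfl | hij
      · simpa using (hasDerivAt_id s).const_add (ξ i)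
      · simpa [hij] using hasDerivAt_const s (ξ i)
    have h3 := (hf.differentiable (by simp) (ξ + Pi.single j s)).hasFDerivAt
    exact (h3.comp_hasDerivAt s h2).deriv

theorem torusMk_add_single {n : ℕ} {L : ℝ} (ξ : Fin n → ℝ) (j : Fin n) (t : ℝ) :
    Torus.mk L ξ + Pi.single j (t : AddCircle L) = Torus.mk L (ξ + Pi.single j t) := by
  funext i
  rcases eq_or_ne i j with rfl | hij
  · simp [Torus.mk]
  · simp [Torus.mk, hij]

theorem torusSmooth_partialDeriv {n : ℕ} {L : ℝ} {F : Type*} [NormedAddCommGroup F]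
    [NormedSpace ℝ F] {f : Torus n L → F} (hf : TorusSmooth f) (l : ℕ) (j : Fin n) :
    TorusSmooth (partialDeriv l j f) := by
  obtain ⟨g, hg, hg'⟩ := exists_iteratedDeriv_line j l _ hf
  have : (fun ξ : Fin n → ℝ => partialDeriv l j f (Torus.mk L ξ)) = g := by
    funext ξ
    simpa [partialDeriv, torusMk_add_single] using hg' ξ 0
  unfold TorusSmooth
  rw [this]
  exact hg

theorem torusSmooth_torusLaplacian {n : ℕ} {L : ℝ} {F : Type*} [NormedAddCommGroup F]
    [NormedSpace ℝ F] {f : Torus n L → F} (hf : TorusSmooth f) :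
    TorusSmooth (torusLaplacian f) :=
  ContDiff.sum (fun j _ => torusSmooth_partialDeriv hf 2 j)

/-! ### The Schrödinger operator `-Δ + V` on the torus -/

/-- The Hilbert space `L²(𝕋ⁿ)`, for the measure of total mass `Lⁿ`. -/
abbrev TorusL2 (n : ℕ) (L : ℝ) [Fact (0 < L)] : Type :=
  Lp ℂ 2 (volume : Measure (Torus n L))

theorem integrable_torusL2_mul {n : ℕ} {L : ℝ} [Fact (0 < L)] (ψ : TorusL2 n L)
    {φ : Torus n L → ℂ} (hφ : Continuous φ) : Integrable (fun x => ψ x * φ x) := by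
  have h1 : Integrable (ψ : Torus n L → ℂ) :=
    (Lp.memLp ψ).integrable (by norm_num)
  obtain ⟨C, hC⟩ := isCompact_univ.exists_bound_of_continuousOn (f := φ) hφ.continuousOn
  exact h1.mul_bdd hφ.aestronglyMeasurable (.of_forall fun x => hC x (Set.mem_univ x))

theorem continuous_schrodinger_test {n : ℕ} {L : ℝ} (V : C(Torus n L, ℝ))
    {φ : Torus n L → ℂ} (hφ : TorusSmooth φ) :
    Continuous (fun x => -torusLaplacian φ x + (V x : ℂ) * φ x) :=
  (continuous_of_torusSmooth (torusSmooth_torusLaplacian hφ)).neg.add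
    ((Complex.continuous_ofReal.comp V.continuous).mul (continuous_of_torusSmooth hφ))

/-- The graph of `-Δ + V` on `L²(𝕋ⁿ)`: the pairs `(ψ, g)` with `-Δψ + Vψ = g` weakly, that is,
`∫ g φ = ∫ ψ (-Δφ + Vφ)` for every smooth test function `φ`. -/
def schrodingerGraph {n : ℕ} {L : ℝ} [Fact (0 < L)] (V : C(Torus n L, ℝ)) :
    Submodule ℂ (TorusL2 n L × TorusL2 n L) where
  carrier := {p | ∀ φ : Torus n L → ℂ, TorusSmooth φ →
    ∫ x, p.2 x * φ x = ∫ x, p.1 x * (-torusLaplacian φ x + (V x : ℂ) * φ x)}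
  add_mem' := by
    intro p q hp hq φ hφ
    have hφc := continuous_of_torusSmooth hφ
    have hc := continuous_schrodinger_test V hφ
    have e1 : ∫ x, (p + q).2 x * φ x = ∫ x, (p.2 x * φ x + q.2 x * φ x) := by
      refine integral_congr_ae ?_
      filter_upwards [Lp.coeFn_add p.2 q.2] with x hx
      rw [Prod.snd_add, hx, Pi.add_apply, add_mul]
    have e2 : ∫ x, (p + q).1 x * (-torusLaplacian φ x + (V x : ℂ) * φ x) =
        ∫ x, (p.1 x * (-torusLaplacian φ x + (V x : ℂ) * φ x) +
          q.1 x * (-torusLaplacian φ x + (V x : ℂ) * φ x)) := by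
      refine integral_congr_ae ?_
      filter_upwards [Lp.coeFn_add p.1 q.1] with x hx
      rw [Prod.fst_add, hx, Pi.add_apply, add_mul]
    rw [e1, e2, integral_add (integrable_torusL2_mul _ hφc)
      (integrable_torusL2_mul _ hφc), integral_add (integrable_torusL2_mul _ hc)
      (integrable_torusL2_mul _ hc), hp φ hφ, hq φ hφ]
  zero_mem' := by
    intro φ _
    have e1 : ∫ x, (0 : TorusL2 n L) x * φ x = 0 := by
      refine integral_eq_zero_of_ae ?_
      filter_upwards [Lp.coeFn_zero ℂ 2 (volume : Measure (Torus n L))] with x hx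
      rw [hx]
      simp
    have e2 : ∫ x, (0 : TorusL2 n L) x * (-torusLaplacian φ x + (V x : ℂ) * φ x) = 0 := by
      refine integral_eq_zero_of_ae ?_
      filter_upwards [Lp.coeFn_zero ℂ 2 (volume : Measure (Torus n L))] with x hx
      rw [hx]
      simp
    exact e1.trans e2.symm
  smul_mem' := by
    intro c p hp φ hφ
    have e1 : ∫ x, (c • p).2 x * φ x = ∫ x, c * (p.2 x * φ x) := by
      refine integral_congr_ae ?_
      filter_upwards [Lp.coeFn_smul c p.2] with x hx
      rw [Prod.smul_snd, hx, Pi.smul_apply, smul_eq_mul, mul_assoc]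
    have e2 : ∫ x, (c • p).1 x * (-torusLaplacian φ x + (V x : ℂ) * φ x) =
        ∫ x, c * (p.1 x * (-torusLaplacian φ x + (V x : ℂ) * φ x)) := by
      refine integral_congr_ae ?_
      filter_upwards [Lp.coeFn_smul c p.1] with x hx
      rw [Prod.smul_fst, hx, Pi.smul_apply, smul_eq_mul, mul_assoc]
    rw [e1, e2, integral_const_mul, integral_const_mul, hp φ hφ]

/-- The Schrödinger operator `-Δ + V` on `L²(𝕋ⁿ)`, with domain
`{ψ ∈ L² : -Δψ + Vψ ∈ L²} = H²(𝕋ⁿ)`, the derivatives being weak ones. -/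
def torusSchrodinger {n : ℕ} {L : ℝ} [Fact (0 < L)] (V : C(Torus n L, ℝ)) :
    TorusL2 n L →ₗ.[ℂ] TorusL2 n L :=
  (schrodingerGraph V).toLinearPMap

/-! ### The grid Hamiltonian `K_Q + V_Q` -/

/-- The labels `𝒩 = {-N/2, …, N/2 - 1}` (for even `N`). -/
abbrev GridLabel (N : ℕ) : Type := ↥(Finset.Ico (-((N : ℤ) / 2)) ((N : ℤ) / 2))

/-- The labels `𝒩ⁿ` of the computational basis. -/
abbrev Grid (n N : ℕ) : Type := Fin n → GridLabel N

/-- The discrete Fourier transform `U_ℱ = U_N ⊗ ⋯ ⊗ U_N`, with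
`U_N |k⟩ = N^{-1/2} ∑_y exp (2 π i k y / N) |y⟩`. -/
def gridFourier (n N : ℕ) : Matrix (Grid n N) (Grid n N) ℂ :=
  Matrix.of fun y k => ∏ i, ((1 / Real.sqrt N : ℝ) : ℂ) *
    Complex.exp (Complex.I * 2 * Real.pi * ((k i : ℤ) : ℂ) * ((y i : ℤ) : ℂ) / (N : ℂ))

/-- `K_Q = ∑_k U_ℱ |k⟩ (4 π² ‖k‖₂² / L²) ⟨k| U_ℱ†`. -/
def gridKinetic (n N : ℕ) (L : ℝ) : Matrix (Grid n N) (Grid n N) ℂ :=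
  gridFourier n N *
    Matrix.diagonal (fun k : Grid n N =>
      ((4 * Real.pi ^ 2 * (∑ i, ((k i : ℤ) : ℝ) ^ 2) / L ^ 2 : ℝ) : ℂ)) *
    (gridFourier n N).conjTranspose

/-- `V_Q = ∑_y |y⟩ V (y L / N) ⟨y|`. -/
def gridPotential {n : ℕ} (N : ℕ) {L : ℝ} (V : Torus n L → ℝ) :
    Matrix (Grid n N) (Grid n N) ℂ :=
  Matrix.diagonal (fun y : Grid n N =>
    ((V (Torus.mk L (fun i => ((y i : ℤ) : ℝ) * L / N)) : ℝ) : ℂ))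

/-- `h_Q = K_Q + V_Q` as an (everywhere defined) operator on `ℂ^{𝒩ⁿ}`. -/
def gridHamiltonian {n : ℕ} (N : ℕ) {L : ℝ} (V : Torus n L → ℝ) :
    EuclideanSpace ℂ (Grid n N) →ₗ.[ℂ] EuclideanSpace ℂ (Grid n N) :=
  (Matrix.toEuclideanLin (gridKinetic n N L + gridPotential N V)).toPMap ⊤

end

/-! Both Hamiltonians have the same shape: in a Fourier basis each is a diagonal kinetic operator
with eigenvalues 4π²‖k‖²/L², plus a symmetric multiplication operator with values in [0, M], M =
V_max. Two estimates compare them.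

Truncation (`IsDiagonalAdd.isTruncatedDomain`). As V ≥ 0, a normalized state of energy at most E has
kinetic energy at most E, so its weight δ² on modes with eigenvalue at least Λ is at most E/Λ.
Projecting these modes away and renormalizing moves the state by at most 2δ, does not raise the
kinetic energy, and changes the potential energy by at most 4Mδ. With Λ = π²N²/(4L²), that is ‖k‖ <
N/4, the retained modes are the same for the torus and the grid, and both spans are truncated
domains.

Quadrature (`equivalentUpTo_of_isDiagonalAdd`, `abs_mean_sub_gridMean_le`). The unitary sends each
retained Fourier mode to the discrete mode with the same label, so kinetic energies agree exactly.
The potential energies are the means of V|u|² over the torus and over the grid, for one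
trigonometric polynomial u with frequencies below N/4. If V is replaced by its Fourier truncation to
the box |q_i| ≤ N/2, all frequencies of the integrand are below N in absolute value and the grid
mean is exact. The error is thus at most twice the uniform norm of the Fourier tail of V, times
‖u‖².

The tail (`Torus.norm_sub_sum_coeff_le`) is bounded by integrating by parts 2n times in the
direction of the largest frequency coordinate. This turns one power |q_j|^(-2n) into a product of n
summable factors, one per coordinate, and is why p is evaluated at 2n. The result is (const ·
L²p(2n)²/N)^n, and since n ≥ 1 a base of at most ε/2 is enough.

The unbounded operator is handled in `mem_schrodingerGraph_iff`, which turns the weak equation into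
a relation between Fourier coefficients; self-adjointness follows from this relation. -/

noncomputable section

/-! ### Bounded perturbations of diagonal operators -/

section DiagonalAdd

variable {H ι : Type*} [NormedAddCommGroup H] [InnerProductSpace ℂ H]

/-- `h` is the sum of the maximal diagonal operator with eigenvalues `κ` in the Hilbert basis `b`
and of the everywhere defined operator `A`. -/
def IsDiagonalAdd (h : H →ₗ.[ℂ] H) (b : HilbertBasis ι ℂ H) (κ : ι → ℝ) (A : H →ₗ[ℂ] H) : Prop :=
  ∀ x w, (x, w) ∈ h.graph ↔ ∀ k, ⟪b k, w⟫_ℂ = κ k * ⟪b k, x⟫_ℂ + ⟪b k, A x⟫_ℂ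

theorem HilbertBasis.ext_inner (b : HilbertBasis ι ℂ H) {x y : H}
    (hxy : ∀ k, ⟪b k, x⟫_ℂ = ⟪b k, y⟫_ℂ) : x = y := by
  apply b.repr.injective
  ext k
  simpa [b.repr_apply_apply] using hxy k

variable {h : H →ₗ.[ℂ] H} {b : HilbertBasis ι ℂ H} {κ : ι → ℝ} {A : H →ₗ[ℂ] H}

namespace IsDiagonalAdd

theorem inner_apply (hd : IsDiagonalAdd h b κ A) (x : h.domain) (k : ι) :
    ⟪b k, h x⟫_ℂ = κ k * ⟪b k, (x : H)⟫_ℂ + ⟪b k, A x⟫_ℂ :=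
  (hd x (h x)).1 (h.mem_graph x) k

theorem basis_mem_graph (hd : IsDiagonalAdd h b κ A) (k : ι) :
    (b k, (κ k : ℂ) • b k + A (b k)) ∈ h.graph := by
  classical
  rw [hd]
  intro l
  rw [inner_add_right, inner_smul_right]
  have := orthonormal_iff_ite.1 b.orthonormal l k
  rw [this]
  split_ifs with hlk
  · rw [hlk]
  · simp

theorem basis_mem_domain (hd : IsDiagonalAdd h b κ A) (k : ι) : b k ∈ h.domain :=
  h.mem_domain_of_mem_graph (hd.basis_mem_graph k)

theorem dense_domain (hd : IsDiagonalAdd h b κ A) : Dense (h.domain : Set H) := by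
  have h1 : Submodule.span ℂ (Set.range b) ≤ h.domain := by
    rw [Submodule.span_le]
    rintro _ ⟨k, rfl⟩
    exact hd.basis_mem_domain k
  have h2 : Dense (Submodule.span ℂ (Set.range b) : Set H) :=
    Submodule.dense_iff_topologicalClosure_eq_top.2 b.dense_span
  exact h2.mono h1

/-- Testing the adjoint relation on basis vectors alone already yields the coefficient relation that
characterizes the graph. The converse is Parseval. -/
theorem isSelfAdjoint [CompleteSpace H] (hd : IsDiagonalAdd h b κ A) (hA : A.IsSymmetric) :
    IsSelfAdjoint h := by
  rw [LinearPMap.isSelfAdjoint_def]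
  apply LinearPMap.eq_of_eq_graph
  rw [LinearPMap.adjoint_graph_eq_graph_adjoint hd.dense_domain]
  ext ⟨y, w⟩
  rw [Submodule.mem_adjoint_iff, hd]
  constructor
  · intro hyw k
    have h1 := hyw _ _ (hd.basis_mem_graph k)
    rw [inner_add_left, inner_smul_left, hA, sub_eq_zero] at h1
    simpa using h1.symm
  · intro hyw x z hxz
    rw [hd] at hxz
    have h1 := b.hasSum_inner_mul_inner z y
    have h2 := b.hasSum_inner_mul_inner x w
    have h3 := b.hasSum_inner_mul_inner (A x) y
    have h4 := b.hasSum_inner_mul_inner x (A y)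
    -- The symmetric part contributes zero to the total, and since `κ` is real each term of the
    -- remaining Parseval series vanishes.
    have h5 := (h1.sub h2).sub (h3.sub h4)
    rw [hA x y, sub_self, sub_zero] at h5
    refine h5.unique ?_
    convert hasSum_zero with k
    rw [hyw k, ← inner_conj_symm z, hxz k, map_add, map_mul, inner_conj_symm, inner_conj_symm,
      Complex.conj_ofReal]
    ring

/-- Parseval for the pairings of `x` with `h x` and with `A x`; the difference is the kinetic
energy, which therefore converges for every vector of the domain. -/
theorem hasSum_kinetic (hd : IsDiagonalAdd h b κ A) (x : h.domain) :
    HasSum (fun k => κ k * ‖⟪b k, (x : H)⟫_ℂ‖ ^ 2)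
      ((⟪(x : H), h x⟫_ℂ).re - (⟪(x : H), A x⟫_ℂ).re) := by
  have h1 := b.hasSum_inner_mul_inner (x : H) (h x)
  have h2 := b.hasSum_inner_mul_inner (x : H) (A x)
  have h3 := Complex.hasSum_re (h1.sub h2)
  rw [Complex.sub_re] at h3
  convert h3 using 2 with k
  rw [hd.inner_apply, mul_add, add_sub_cancel_right, ← inner_conj_symm (x : H),
    mul_left_comm, Complex.conj_mul']
  norm_cast

end IsDiagonalAdd

theorem HilbertBasis.hasSum_norm_sq (b : HilbertBasis ι ℂ H) (x : H) :
    HasSum (fun k => ‖⟪b k, x⟫_ℂ‖ ^ 2) (‖x‖ ^ 2) := by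
  have h1 := Complex.hasSum_re (b.hasSum_inner_mul_inner x x)
  convert h1 using 2 with k
  · rw [← inner_conj_symm x, Complex.conj_mul']
    norm_cast
  · rw [inner_self_eq_norm_sq_to_K]
    norm_cast

theorem inner_sum_smul_embedding {σ : Type*} [Fintype σ] (b : HilbertBasis ι ℂ H) (f : σ ↪ ι)
    (c : σ → ℂ) (s : σ) : ⟪b (f s), ∑ t, c t • b (f t)⟫_ℂ = c s := by
  exact (b.orthonormal.comp f f.injective).inner_right_fintype c s

theorem inner_sum_smul_embedding_of_notMem {σ : Type*} [Fintype σ] (b : HilbertBasis ι ℂ H)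
    (f : σ ↪ ι) (c : σ → ℂ) {k : ι} (hk : k ∉ Set.range f) :
    ⟪b k, ∑ t, c t • b (f t)⟫_ℂ = 0 := by
  rw [inner_sum]
  refine Finset.sum_eq_zero fun t _ => ?_
  rw [inner_smul_right, b.orthonormal.2 (fun e => hk ⟨t, e.symm⟩), mul_zero]

theorem norm_sq_sum_smul_embedding {σ : Type*} [Fintype σ] (b : HilbertBasis ι ℂ H) (f : σ ↪ ι)
    (c : σ → ℂ) : ‖∑ t, c t • b (f t)‖ ^ 2 = ∑ t, ‖c t‖ ^ 2 := by
  have h1 := (b.orthonormal.comp f f.injective).inner_sum c c Finset.univ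
  have h2 := congrArg Complex.re h1
  simp only [Function.comp_apply] at h2
  rw [inner_self_eq_norm_sq_to_K] at h2
  have h3 : ∀ z : ℂ, (starRingEnd ℂ) z * z = ((‖z‖ ^ 2 : ℝ) : ℂ) := fun z => by
    rw [Complex.conj_mul']; norm_cast
  simp only [h3] at h2
  exact_mod_cast h2

namespace IsDiagonalAdd

/-- The kinetic energy of a finite combination of basis vectors. -/
theorem re_inner_sum (hd : IsDiagonalAdd h b κ A) {σ : Type*} [Fintype σ] (f : σ ↪ ι)
    (c : σ → ℂ) (x : h.domain) (hx : (x : H) = ∑ t, c t • b (f t)) :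
    (⟪(x : H), h x⟫_ℂ).re = ∑ t, κ (f t) * ‖c t‖ ^ 2 + (⟪(x : H), A x⟫_ℂ).re := by
  rw [← sub_eq_iff_eq_add]
  refine (hd.hasSum_kinetic x).unique ?_
  have h1 : HasSum (fun t => κ (f t) * ‖⟪b (f t), (x : H)⟫_ℂ‖ ^ 2)
      (∑ t, κ (f t) * ‖c t‖ ^ 2) := by
    convert hasSum_fintype _ using 4 with t
    rw [hx, inner_sum_smul_embedding]
  refine (f.injective.hasSum_iff (f := fun k => κ k * ‖⟪b k, (x : H)⟫_ℂ‖ ^ 2) ?_).1 h1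
  intro k hk
  rw [hx, inner_sum_smul_embedding_of_notMem b f c hk]
  simp

/-- The truncation is the normalized projection onto the modes below `Λ`. The bound `hE` is needed
only for `0 ≤ E`, because no state has energy at most a negative `E`. -/
theorem isTruncatedDomain (hd : IsDiagonalAdd h b κ A) (hκ : ∀ k, 0 ≤ κ k)
    {M : ℝ} (hA0 : ∀ x, 0 ≤ (⟪x, A x⟫_ℂ).re) (hAM : ∀ x, ‖A x‖ ≤ M * ‖x‖) (hM : 0 ≤ M)
    {Λ : ℝ} (hΛ : 0 < Λ) {σ : Type*} [Fintype σ] (f : σ ↪ ι)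
    (hf : ∀ k, k ∈ Set.range f ↔ κ k < Λ) {D : Submodule ℂ H} (hD : ∀ s, b (f s) ∈ D)
    {E ε : ℝ} (hε : 0 < ε) (hε1 : ε < 1) (hE : 0 ≤ E → 16 * (1 + M) ^ 2 * E ≤ ε ^ 2 * Λ) :
    IsTruncatedDomain h E ε D := by
  intro x hx hxE
  set y : H := ∑ s, ⟪b (f s), (x : H)⟫_ℂ • b (f s) with hy
  set K := (⟪(x : H), h x⟫_ℂ).re - (⟪(x : H), A x⟫_ℂ).re with hK
  set KS := ∑ s, κ (f s) * ‖⟪b (f s), (x : H)⟫_ℂ‖ ^ 2 with hKS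
  have hyn : ‖y‖ ^ 2 = ∑ s, ‖⟪b (f s), (x : H)⟫_ℂ‖ ^ 2 := norm_sq_sum_smul_embedding b f _
  have hxx := hA0 x
  have hen : energy h x = (⟪(x : H), h x⟫_ℂ).re := by simp [energy, hx]
  have hsum := hd.hasSum_kinetic x
  have hone := b.hasSum_norm_sq (x : H)
  rw [hx, one_pow] at hone
  have hK0 : 0 ≤ K := hsum.nonneg fun k => mul_nonneg (hκ k) (by positivity)
  have hKE : K ≤ E := by linarith
  have hES := hE (hK0.trans hKE)
  -- splitting of the kinetic energy
  have hsplit : KS - Λ * ‖y‖ ^ 2 ≤ K - Λ := by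
    have h1 : HasSum (fun k => (κ k - Λ) * ‖⟪b k, (x : H)⟫_ℂ‖ ^ 2) (K - Λ) := by
      simpa [sub_mul] using hsum.sub (hone.mul_left Λ)
    have h2 : KS - Λ * ‖y‖ ^ 2 = ∑ k ∈ Finset.univ.map f, (κ k - Λ) * ‖⟪b k, (x : H)⟫_ℂ‖ ^ 2 := by
      rw [Finset.sum_map, hyn, hKS, Finset.mul_sum, ← Finset.sum_sub_distrib]
      simp [sub_mul]
    rw [h2]
    refine sum_le_hasSum _ (fun k hk => mul_nonneg ?_ (by positivity)) h1
    have : ¬ κ k < Λ := fun h' => hk (by simpa using (hf k).2 h')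
    linarith
  have hKS1 : KS ≤ Λ * ‖y‖ ^ 2 := by
    rw [hyn, hKS, Finset.mul_sum]
    refine Finset.sum_le_sum fun s _ => ?_
    gcongr
    exact ((hf _).1 ⟨s, rfl⟩).le
  have hKS0 : 0 ≤ KS := Finset.sum_nonneg fun s _ => mul_nonneg (hκ _) (by positivity)
  -- the distance between `x` and `y`
  have horth : ⟪y, (x : H) - y⟫_ℂ = 0 := by
    rw [hy, sum_inner]
    refine Finset.sum_eq_zero fun s _ => ?_
    rw [inner_smul_left, inner_sub_right, inner_sum_smul_embedding b f, sub_self, mul_zero]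
  have hpyth : 1 = ‖y‖ ^ 2 + ‖(x : H) - y‖ ^ 2 := by
    have := norm_add_sq_eq_norm_sq_add_norm_sq_of_inner_eq_zero y ((x : H) - y) horth
    rw [add_sub_cancel, hx] at this
    linarith
  set δ := ‖(x : H) - y‖ with hδ
  have hδ0 : 0 ≤ δ := norm_nonneg _
  have hδ2 : Λ * δ ^ 2 ≤ E := by nlinarith
  -- The factor `4 * (1 + M)` covers both the displacement `2 * δ` and the potential change `4 * M *
  -- δ`.
  have hδM : (4 * (1 + M) * δ) ^ 2 ≤ ε ^ 2 := by
    have : (4 * (1 + M) * δ) ^ 2 * Λ ≤ ε ^ 2 * Λ := by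
      calc (4 * (1 + M) * δ) ^ 2 * Λ = 16 * (1 + M) ^ 2 * (Λ * δ ^ 2) := by ring
        _ ≤ 16 * (1 + M) ^ 2 * E := by gcongr
        _ ≤ _ := hES
    exact le_of_mul_le_mul_right this hΛ
  have hδM' : 4 * (1 + M) * δ ≤ ε := abs_le_of_sq_le_sq' hδM hε.le |>.2
  have hMδ : 0 ≤ M * δ := mul_nonneg hM hδ0
  have hδ4 : δ ≤ 1 / 4 := by nlinarith
  set c := ‖y‖ with hc
  have hc0 : 0 < c := by
    have : 0 < c ^ 2 := by nlinarith
    exact lt_of_pow_lt_pow_left₀ 2 (norm_nonneg y) (by simpa using this)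
  have hc1 : c ≤ 1 := by nlinarith
  have hyD : y ∈ D := Submodule.sum_mem _ fun s _ => D.smul_mem _ (hD s)
  have hyd : y ∈ h.domain :=
    Submodule.sum_mem _ fun s _ => h.domain.smul_mem _ (hd.basis_mem_domain _)
  set x' : h.domain := ⟨((c⁻¹ : ℝ) : ℂ) • y, h.domain.smul_mem _ hyd⟩ with hx'
  have hx'n : ‖(x' : H)‖ = 1 := by
    simp only [hx', norm_smul, Complex.norm_real, norm_inv, Real.norm_eq_abs, abs_of_pos hc0]
    exact inv_mul_cancel₀ hc0.ne'
  -- Projection costs `δ` and renormalization costs `1 - c ≤ 1 - c ^ 2 = δ ^ 2 ≤ δ`.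
  have hdist : ‖(x' : H) - x‖ ≤ 2 * δ := by
    have e1 : (x' : H) - x = ((c⁻¹ - 1 : ℝ) : ℂ) • y - ((x : H) - y) := by
      simp only [hx', Complex.ofReal_sub, sub_smul, Complex.ofReal_one, one_smul]
      abel
    have e2 : ‖((c⁻¹ - 1 : ℝ) : ℂ) • y‖ = 1 - c := by
      have : 0 ≤ c⁻¹ - 1 := by
        rw [sub_nonneg]; exact (one_le_inv₀ hc0).2 hc1
      rw [norm_smul, Complex.norm_real, Real.norm_eq_abs, abs_of_nonneg this, ← hc, sub_mul,
        inv_mul_cancel₀ hc0.ne', one_mul]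
    rw [e1]
    refine (norm_sub_le _ _).trans ?_
    rw [e2]
    nlinarith
  have hsum' : (x' : H) = ∑ s, (((c⁻¹ : ℝ) : ℂ) * ⟪b (f s), (x : H)⟫_ℂ) • b (f s) := by
    simp only [hx', hy, Finset.smul_sum, smul_smul]
  have hen' : energy h x' = c⁻¹ ^ 2 * KS + (⟪(x' : H), A x'⟫_ℂ).re := by
    rw [energy, hx'n, one_pow, div_one, hd.re_inner_sum f _ x' hsum', hKS, Finset.mul_sum]
    congr 1
    refine Finset.sum_congr rfl fun s _ => ?_
    rw [norm_mul, Complex.norm_real, mul_pow, Real.norm_eq_abs, sq_abs]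
    ring
  have hδε : 4 * δ + 4 * M * δ ≤ ε := by linarith
  refine ⟨x', D.smul_mem _ hyD, hx'n, ?_, by linarith⟩
  rw [hen', hen]
  -- The discarded weight `δ ^ 2` carries kinetic energy at least `Λ` per unit, the retained weight
  -- at most `Λ`. Rescaling the retained part to unit weight therefore cannot exceed the original.
  have hkin : c⁻¹ ^ 2 * KS ≤ K := by
    rw [inv_pow, inv_mul_le_iff₀ (by positivity)]
    have e1 : KS + Λ * δ ^ 2 ≤ K := by linear_combination hsplit - Λ * hpyth
    calc KS = c ^ 2 * KS + δ ^ 2 * KS := by rw [← add_mul, ← hpyth, one_mul]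
      _ ≤ c ^ 2 * KS + δ ^ 2 * (Λ * c ^ 2) := by gcongr
      _ = c ^ 2 * (KS + Λ * δ ^ 2) := by ring
      _ ≤ c ^ 2 * K := by gcongr
  have hpot : (⟪(x' : H), A x'⟫_ℂ).re - (⟪(x : H), A x⟫_ℂ).re ≤ 4 * M * δ := by
    have e1 : ⟪(x' : H), A x'⟫_ℂ - ⟪(x : H), A x⟫_ℂ =
        ⟪(x' : H) - x, A x'⟫_ℂ + ⟪(x : H), A ((x' : H) - x)⟫_ℂ := by
      rw [map_sub, inner_sub_left, inner_sub_right]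
      ring
    rw [← Complex.sub_re, e1, Complex.add_re]
    have e2 := (Complex.re_le_norm _).trans (norm_inner_le_norm (𝕜 := ℂ) ((x' : H) - x) (A x'))
    have e3 := (Complex.re_le_norm _).trans
      (norm_inner_le_norm (𝕜 := ℂ) (x : H) (A ((x' : H) - x)))
    have e4 := hAM x'
    have e5 := hAM ((x' : H) - x)
    rw [hx'n, mul_one] at e4
    rw [hx, one_mul] at e3
    have e6 : ‖(x' : H) - x‖ * ‖A x'‖ ≤ 2 * δ * M := by gcongr
    have e7 : M * ‖(x' : H) - x‖ ≤ M * (2 * δ) := by gcongr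
    linarith
  linarith

end IsDiagonalAdd

end DiagonalAdd

/-- The isometry from `ℂ^σ` given by an orthonormal family. -/
def Orthonormal.isometryOfFintype {H σ : Type*} [NormedAddCommGroup H] [InnerProductSpace ℂ H]
    [Fintype σ] {v : σ → H} (hv : Orthonormal ℂ v) : EuclideanSpace ℂ σ →ₗᵢ[ℂ] H where
  toFun c := ∑ s, c s • v s
  map_add' c d := by simp [add_smul, Finset.sum_add_distrib]
  map_smul' a c := by simp [mul_smul, Finset.smul_sum]
  norm_map' c := by
    have h1 := congrArg Complex.re (hv.inner_sum c c Finset.univ)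
    rw [inner_self_eq_norm_sq_to_K] at h1
    have h3 : ∀ z : ℂ, (starRingEnd ℂ) z * z = ((‖z‖ ^ 2 : ℝ) : ℂ) := fun z => by
      rw [Complex.conj_mul']; norm_cast
    simp only [h3] at h1
    rw [← sq_eq_sq₀ (norm_nonneg _) (norm_nonneg _), EuclideanSpace.norm_sq_eq]
    exact_mod_cast h1

/-- The unitary matches the basis vectors below the cutoff `Λ`. Their eigenvalues agree, so kinetic
energies cancel and only the difference of the two perturbation forms, bounded by `hform`, remains.
-/
theorem equivalentUpTo_of_isDiagonalAdd {Ha Hb ιa ιb σ : Type*}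
    [NormedAddCommGroup Ha] [InnerProductSpace ℂ Ha] [CompleteSpace Ha]
    [NormedAddCommGroup Hb] [InnerProductSpace ℂ Hb] [CompleteSpace Hb] [Fintype σ]
    {ha : Ha →ₗ.[ℂ] Ha} {ba : HilbertBasis ιa ℂ Ha} {κa : ιa → ℝ} {A : Ha →ₗ[ℂ] Ha}
    {hb : Hb →ₗ.[ℂ] Hb} {bb : HilbertBasis ιb ℂ Hb} {κb : ιb → ℝ} {B : Hb →ₗ[ℂ] Hb}
    (hda : IsDiagonalAdd ha ba κa A) (hdb : IsDiagonalAdd hb bb κb B)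
    (hκa : ∀ k, 0 ≤ κa k) (hκb : ∀ k, 0 ≤ κb k)
    {M : ℝ} (hM : 0 ≤ M)
    (hAs : A.IsSymmetric) (hA0 : ∀ x, 0 ≤ (⟪x, A x⟫_ℂ).re) (hAM : ∀ x, ‖A x‖ ≤ M * ‖x‖)
    (hBs : B.IsSymmetric) (hB0 : ∀ x, 0 ≤ (⟪x, B x⟫_ℂ).re) (hBM : ∀ x, ‖B x‖ ≤ M * ‖x‖)
    {Λ : ℝ} (hΛ : 0 < Λ) (fa : σ ↪ ιa) (fb : σ ↪ ιb)
    (hfa : ∀ k, k ∈ Set.range fa ↔ κa k < Λ) (hfb : ∀ k, k ∈ Set.range fb ↔ κb k < Λ)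
    (hκ : ∀ s, κa (fa s) = κb (fb s))
    {E ε : ℝ} (hε : 0 < ε) (hε1 : ε < 1) (hE : 0 ≤ E → 16 * (1 + M) ^ 2 * E ≤ ε ^ 2 * Λ)
    (hform : ∀ c : σ → ℂ,
      |(⟪∑ s, c s • ba (fa s), A (∑ s, c s • ba (fa s))⟫_ℂ).re -
        (⟪∑ s, c s • bb (fb s), B (∑ s, c s • bb (fb s))⟫_ℂ).re| ≤ ε * ∑ s, ‖c s‖ ^ 2) :
    EquivalentUpTo ha hb E ε := by
  classical
  refine ⟨hda.isSelfAdjoint hAs, hdb.isSelfAdjoint hBs, ?_⟩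
  let ja := (ba.orthonormal.comp fa fa.injective).isometryOfFintype
  let jb := (bb.orthonormal.comp fb fb.injective).isometryOfFintype
  have hja : ∀ c, ja c = ∑ s, c s • ba (fa s) := fun c => rfl
  have hjb : ∀ c, jb c = ∑ s, c s • bb (fb s) := fun c => rfl
  have hDa : LinearMap.range ja.toLinearMap ≤ ha.domain := by
    rintro _ ⟨c, rfl⟩
    exact Submodule.sum_mem _ fun s _ => ha.domain.smul_mem _ (hda.basis_mem_domain _)
  have hDb : LinearMap.range jb.toLinearMap ≤ hb.domain := by
    rintro _ ⟨c, rfl⟩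
    exact Submodule.sum_mem _ fun s _ => hb.domain.smul_mem _ (hdb.basis_mem_domain _)
  refine ⟨LinearMap.range ja.toLinearMap, LinearMap.range jb.toLinearMap, hDa, hDb,
    ja.equivRange.symm.trans jb.equivRange,
    hda.isTruncatedDomain hκa hA0 hAM hM hΛ fa hfa (fun s => ?_) hε hε1 hE,
    hdb.isTruncatedDomain hκb hB0 hBM hM hΛ fb hfb (fun s => ?_) hε hε1 hE, ?_⟩
  · refine ⟨EuclideanSpace.single s 1, ?_⟩
    change ja _ = _
    rw [hja, Finset.sum_eq_single s] <;> simp +contextual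
  · refine ⟨EuclideanSpace.single s 1, ?_⟩
    change jb _ = _
    rw [hjb, Finset.sum_eq_single s] <;> simp +contextual
  · intro ψ hψ
    obtain ⟨c, rfl⟩ := ja.equivRange.surjective ψ
    have hc0 : c ≠ 0 := fun h0 => hψ (by rw [h0, map_zero])
    have hcn : 0 < ‖c‖ := norm_pos_iff.2 hc0
    have h3 := hform c
    have h4 : ‖∑ s, c s • ba (fa s)‖ = ‖c‖ := ja.norm_map c
    have h5 : ‖∑ s, c s • bb (fb s)‖ = ‖c‖ := jb.norm_map c
    have h1 : energy ha ⟨ja.equivRange c, hDa (ja.equivRange c).2⟩ =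
        (∑ s, κa (fa s) * ‖c s‖ ^ 2 + (⟪∑ s, c s • ba (fa s),
          A (∑ s, c s • ba (fa s))⟫_ℂ).re) / ‖c‖ ^ 2 := by
      rw [energy, hda.re_inner_sum fa c ⟨ja.equivRange c, hDa (ja.equivRange c).2⟩ rfl, ← h4]
      rfl
    have h2 : energy hb ⟨jb.equivRange c, hDb (jb.equivRange c).2⟩ =
        (∑ s, κb (fb s) * ‖c s‖ ^ 2 + (⟪∑ s, c s • bb (fb s),
          B (∑ s, c s • bb (fb s))⟫_ℂ).re) / ‖c‖ ^ 2 := by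
      rw [energy, hdb.re_inner_sum fb c ⟨jb.equivRange c, hDb (jb.equivRange c).2⟩ rfl, ← h5]
      rfl
    simp only [LinearIsometryEquiv.trans_apply, LinearIsometryEquiv.symm_apply_apply]
    rw [h1, h2, ← sub_div, abs_div, abs_of_pos (by positivity : 0 < ‖c‖ ^ 2),
      div_le_iff₀ (by positivity), EuclideanSpace.norm_sq_eq]
    simpa only [hκ, add_sub_add_left_eq_sub] using h3

/-! ### Partial derivatives on the torus -/

section PartialDeriv

variable {n : ℕ} {L : ℝ} {F : Type*} [NormedAddCommGroup F] [NormedSpace ℝ F]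

theorem Torus.mk_surjective (x : Torus n L) : ∃ ξ, Torus.mk L ξ = x :=
  (isOpenQuotientMap_torusMk L).surjective x

/-- Translation along a line makes the derivatives at all its points those of one function of a real
variable, so they can be differentiated again. -/
theorem partialDeriv_add_single (l : ℕ) (j : Fin n) (f : Torus n L → F) (x : Torus n L) (t : ℝ) :
    partialDeriv l j f (x + Pi.single j (t : AddCircle L)) =
      iteratedDeriv l (fun s : ℝ => f (x + Pi.single j (s : AddCircle L))) t := by
  have h1 : (fun s : ℝ => f (x + Pi.single j (t : AddCircle L) + Pi.single j (s : AddCircle L))) =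
      fun s : ℝ => (fun s : ℝ => f (x + Pi.single j (s : AddCircle L))) (t + s) := by
    funext s
    simp only [AddCircle.coe_add, Pi.single_add, add_assoc]
  rw [partialDeriv, h1]
  exact (congrFun (iteratedDeriv_comp_const_add l
    (fun s : ℝ => f (x + Pi.single j (s : AddCircle L))) t) 0).trans (by rw [add_zero])

theorem TorusSmooth.contDiff_line {f : Torus n L → F} (hf : TorusSmooth f) (j : Fin n)
    (x : Torus n L) : ContDiff ℝ ∞ (fun t : ℝ => f (x + Pi.single j (t : AddCircle L))) := by
  obtain ⟨ξ, rfl⟩ := Torus.mk_surjective x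
  simp only [torusMk_add_single]
  exact ContDiff.comp (g := fun ξ : Fin n → ℝ => f (Torus.mk L ξ)) hf (contDiff_const.add (ContinuousLinearMap.single ℝ (fun _ => ℝ) j).contDiff)

theorem TorusSmooth.hasDerivAt_partialDeriv {f : Torus n L → F} (hf : TorusSmooth f) (l : ℕ)
    (j : Fin n) (x : Torus n L) (t : ℝ) :
    HasDerivAt (fun t : ℝ => partialDeriv l j f (x + Pi.single j (t : AddCircle L)))
      (partialDeriv (l + 1) j f (x + Pi.single j (t : AddCircle L))) t := by
  simp only [partialDeriv_add_single, iteratedDeriv_succ]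
  exact (((hf.contDiff_line j x).differentiable_iteratedDeriv l
    (by exact_mod_cast WithTop.coe_lt_top _)) t).hasDerivAt

theorem partialDeriv_zero (j : Fin n) (f : Torus n L → F) : partialDeriv 0 j f = f := by
  funext x
  simp [partialDeriv]

theorem TorusSmooth.ofReal {f : Torus n L → ℝ} (hf : TorusSmooth f) :
    TorusSmooth (fun x => (f x : ℂ)) :=
  Complex.ofRealCLM.contDiff.comp hf

theorem partialDeriv_ofReal {f : Torus n L → ℝ} (hf : TorusSmooth f) (l : ℕ) (j : Fin n)
    (x : Torus n L) :
    partialDeriv l j (fun x => (f x : ℂ)) x = ((partialDeriv l j f x : ℝ) : ℂ) := by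
  induction l generalizing x with
  | zero => simp [partialDeriv_zero]
  | succ l ih =>
    have h1 := hf.ofReal.hasDerivAt_partialDeriv l j x 0
    have h2 := (hf.hasDerivAt_partialDeriv l j x 0).ofReal_comp
    simp only [ih] at h1
    simpa using h1.unique h2

/-- Compactness of the torus. Without boundedness the real `sSup` would take the default value 0,
and a bound on the smoothness factor would carry no information. -/
theorem bddAbove_smoothnessFactor {V : Torus n L → ℝ} [Fact (0 < L)] (hV : TorusSmooth V) (m : ℕ) :
    BddAbove {r : ℝ | ∃ l ∈ Finset.Icc 1 m, ∃ (j : Fin n) (x : Torus n L),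
      r = Real.posLog |partialDeriv l j V x| / l} := by
  have h1 : ∀ (l : ℕ) (j : Fin n), BddAbove (Set.range fun x : Torus n L =>
      Real.posLog |partialDeriv l j V x| / l) := by
    intro l j
    refine (isCompact_range ?_).bddAbove
    have := continuous_of_torusSmooth (torusSmooth_partialDeriv hV l j)
    exact (Real.continuous_posLog.comp this.abs).div_const _
  have h2 : BddAbove (⋃ l ∈ Finset.Icc 1 m, ⋃ j : Fin n, Set.range fun x : Torus n L =>
      Real.posLog |partialDeriv l j V x| / l) := by
    refine (Set.Finite.bddAbove_biUnion (Finset.finite_toSet (Finset.Icc 1 m))).2 ?_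
    intro l _
    have := (Set.finite_univ (α := Fin n)).bddAbove_biUnion (S := fun j =>
      Set.range fun x : Torus n L => Real.posLog |partialDeriv l j V x| / l)
    simp only [Set.mem_univ, Set.iUnion_true, forall_true_left] at this
    exact this.2 (h1 l)
  refine h2.mono ?_
  rintro _ ⟨l, hl, j, x, rfl⟩
  simp only [Set.mem_iUnion]
  exact ⟨l, hl, j, x, rfl⟩

theorem abs_partialDeriv_le_of_smoothnessFactor_le {V : Torus n L → ℝ} [Fact (0 < L)]
    (hV : TorusSmooth V) {m : ℕ} {P : ℝ} (hP : 0 < P) (h : smoothnessFactor V m ≤ Real.log P)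
    {l : ℕ} (hl : l ∈ Finset.Icc 1 m) (j : Fin n) (x : Torus n L) :
    |partialDeriv l j V x| ≤ P ^ l := by
  have h1 : Real.posLog |partialDeriv l j V x| / l ≤ Real.log P :=
    (le_csSup (bddAbove_smoothnessFactor hV m) ⟨l, hl, j, x, rfl⟩).trans h
  have hl0 : (0 : ℝ) < l := by exact_mod_cast (Finset.mem_Icc.1 hl).1
  rw [div_le_iff₀ hl0] at h1
  have h2 : Real.log |partialDeriv l j V x| ≤ Real.log (P ^ l) := by
    rw [Real.log_pow, mul_comm]
    exact (le_max_right _ _).trans h1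
  -- A vanishing derivative is separate, since comparing logarithms requires positive arguments.
  rcases (abs_nonneg (partialDeriv l j V x)).eq_or_lt with h0 | h0
  · rw [← h0]; positivity
  · exact (Real.log_le_log_iff h0 (by positivity)).1 h2

theorem one_le_of_smoothnessFactor_le {V : Torus n L → ℝ} {m : ℕ} {P : ℝ} (hP : 0 < P)
    (h : smoothnessFactor V m ≤ Real.log P) : 1 ≤ P := by
  have h1 : 0 ≤ smoothnessFactor V m := by
    refine Real.sSup_nonneg ?_
    rintro _ ⟨l, -, j, x, rfl⟩
    exact div_nonneg Real.posLog_nonneg (Nat.cast_nonneg l)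
  exact (Real.log_nonneg_iff hP).1 (h1.trans h)

end PartialDeriv

/-! ### Fourier series on the torus -/

namespace Torus

variable {n : ℕ} {L : ℝ}

/-- The monomials `exp (2 π i ⟨k, x⟩ / L)`. -/
def monomial (L : ℝ) (k : Fin n → ℤ) : C(Torus n L, ℂ) where
  toFun x := ∏ i, fourier (k i) (x i)
  continuous_toFun := by fun_prop

theorem monomial_apply (k : Fin n → ℤ) (x : Torus n L) :
    monomial L k x = ∏ i, fourier (k i) (x i) := rfl

theorem monomial_neg (k : Fin n → ℤ) (x : Torus n L) :
    monomial L (-k) x = (starRingEnd ℂ) (monomial L k x) := by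
  simp only [monomial_apply, Pi.neg_apply, fourier_neg, map_prod]

theorem monomial_add (k l : Fin n → ℤ) (x : Torus n L) :
    monomial L (k + l) x = monomial L k x * monomial L l x := by
  simp only [monomial_apply, Pi.add_apply, fourier_add, ← Finset.prod_mul_distrib]

theorem monomial_zero : monomial L (0 : Fin n → ℤ) = 1 := by
  ext x
  simp [monomial_apply]

theorem norm_monomial_apply (k : Fin n → ℤ) (x : Torus n L) : ‖monomial L k x‖ = 1 := by
  simp only [monomial_apply, norm_prod, fourier_apply, Circle.norm_coe, Finset.prod_const_one]

theorem monomial_mk (k : Fin n → ℤ) (ξ : Fin n → ℝ) :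
    monomial L k (Torus.mk L ξ) = ∏ i, Complex.exp (2 * Real.pi * Complex.I * k i * ξ i / L) := by
  simp only [monomial_apply, Torus.mk, fourier_coe_apply]

theorem torusSmooth_monomial (k : Fin n → ℤ) : TorusSmooth (monomial L k) := by
  unfold TorusSmooth
  simp only [monomial_mk]
  refine contDiff_prod fun i _ => ?_
  have h1 : ContDiff ℝ ∞ (fun ξ : Fin n → ℝ => (ξ i : ℂ)) :=
    Complex.ofRealCLM.contDiff.comp (contDiff_apply ℝ ℝ i)
  exact ((contDiff_const.mul h1).div_const _).cexp

theorem monomial_add_single (k : Fin n → ℤ) (j : Fin n) (x : Torus n L) (t : ℝ) :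
    monomial L k (x + Pi.single j (t : AddCircle L)) =
      Complex.exp (2 * Real.pi * Complex.I * k j / L * t) * monomial L k x := by
  classical
  have h1 : monomial L k (x + Pi.single j (t : AddCircle L)) =
      monomial L k (Pi.single j (t : AddCircle L)) * monomial L k x := by
    simp only [monomial_apply, ← Finset.prod_mul_distrib]
    refine Finset.prod_congr rfl fun i _ => ?_
    simp [mul_comm, AddCircle.toCircle_add]
  have h2 : monomial L k (Pi.single j (t : AddCircle L)) =
      Complex.exp (2 * Real.pi * Complex.I * k j / L * t) := by
    rw [monomial_apply, Finset.prod_eq_single j]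
    · rw [Pi.single_eq_same, fourier_coe_apply]
      congr 1
      ring
    · intro i _ hi
      rw [Pi.single_eq_of_ne hi, fourier_eval_zero]
    · simp
  rw [h1, h2]

theorem hasDerivAt_monomial_line (k : Fin n → ℤ) (j : Fin n) (x : Torus n L) (t : ℝ) :
    HasDerivAt (fun t : ℝ => monomial L k (x + Pi.single j (t : AddCircle L)))
      (2 * Real.pi * Complex.I * k j / L *
        monomial L k (x + Pi.single j (t : AddCircle L))) t := by
  simp only [monomial_add_single]
  set a := 2 * Real.pi * Complex.I * k j / L
  have h1 : HasDerivAt (fun t : ℝ => a * (t : ℂ)) a t := by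
    simpa using (hasDerivAt_id t).ofReal_comp.const_mul a
  have h2 := h1.cexp.mul_const (monomial L k x)
  rwa [mul_comm (Complex.exp _) a, mul_assoc] at h2

/-- The linear span of the monomials is dense in `C(𝕋ⁿ, ℂ)`. -/
theorem span_monomial_closure_eq_top [Fact (0 < L)] :
    (Submodule.span ℂ (Set.range (monomial (n := n) L))).topologicalClosure = ⊤ := by
  let S : StarSubalgebra ℂ C(Torus n L, ℂ) :=
    { toSubalgebra := Algebra.adjoin ℂ (Set.range (monomial L))
      star_mem' := by
        change Algebra.adjoin ℂ (Set.range (monomial L)) ≤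
          star (Algebra.adjoin ℂ (Set.range (monomial L)))
        refine Algebra.adjoin_le ?_
        rintro _ ⟨k, rfl⟩
        refine Algebra.subset_adjoin ⟨-k, ?_⟩
        ext1 x
        simp only [monomial_neg, starRingEnd_apply, ContinuousMap.star_apply] }
  have hS : S.toSubalgebra.toSubmodule = Submodule.span ℂ (Set.range (monomial L)) := by
    apply Algebra.adjoin_eq_span_of_subset
    -- The monomials are closed under multiplication, so the algebra they generate is just their
    -- linear span and Stone–Weierstrass applies to it.
    refine .trans (fun x ↦ Submonoid.closure_induction (fun _ ↦ id) ⟨0, ?_⟩ ?_)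
      Submodule.subset_span
    · exact monomial_zero
    · rintro _ _ _ _ ⟨k, rfl⟩ ⟨l, rfl⟩
      refine ⟨k + l, ?_⟩
      ext z
      exact monomial_add k l z
  have hsep : S.SeparatesPoints := by
    intro x y hxy
    obtain ⟨i, hi⟩ := Function.ne_iff.1 hxy
    -- The monomial of frequency 1 in a coordinate where the points differ separates them.
    have h1 : ∀ z : Torus n L, monomial L (Pi.single i 1) z = (AddCircle.toCircle (z i) : ℂ) := by
      intro z
      rw [monomial_apply, Finset.prod_eq_single i]
      · simp
      · intro j _ hj
        rw [Pi.single_eq_of_ne hj, fourier_zero]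
      · simp
    refine ⟨_, ⟨monomial L (Pi.single i 1), Algebra.subset_adjoin ⟨Pi.single i 1, rfl⟩, rfl⟩, ?_⟩
    dsimp only
    rw [h1, h1]
    exact fun h => hi (AddCircle.injective_toCircle (Fact.out : 0 < L).ne' (Circle.ext h))
  rw [← hS]
  exact congr_arg (Subalgebra.toSubmodule <| StarSubalgebra.toSubalgebra ·)
    (ContinuousMap.starSubalgebra_topologicalClosure_eq_top_of_separatesPoints _ hsep)

theorem integral_fourier [hL : Fact (0 < L)] (q : ℤ) :
    ∫ x : AddCircle L, fourier q x = if q = 0 then (L : ℂ) else 0 := by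
  have h1 := congrFun (fourierCoeff_fourier (T := L) q) 0
  rw [fourierCoeff, AddCircle.integral_haarAddCircle] at h1
  simp only [neg_zero, fourier_zero, one_smul] at h1
  rw [inv_smul_eq_iff₀ hL.out.ne'] at h1
  rw [h1]
  split_ifs with hq
  · simp [hq]
  · simp [Pi.single_eq_of_ne (Ne.symm hq)]

theorem integral_monomial [Fact (0 < L)] (k : Fin n → ℤ) :
    ∫ x, monomial L k x = if k = 0 then (L : ℂ) ^ n else 0 := by
  simp only [monomial_apply]
  rw [integral_fintype_prod_volume_eq_prod]
  simp only [integral_fourier]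
  split_ifs with hk
  · simp [hk]
  · obtain ⟨i, hi⟩ := Function.ne_iff.mp hk
    exact Finset.prod_eq_zero (Finset.mem_univ i) (if_neg hi)

/-- The norm of a monomial in `L²(𝕋ⁿ)` is the square root of the volume. -/
def rootVolume (n : ℕ) (L : ℝ) : ℝ := Real.sqrt (L ^ n)

theorem rootVolume_pos [hL : Fact (0 < L)] : 0 < rootVolume n L :=
  Real.sqrt_pos.2 (pow_pos hL.out n)

theorem rootVolume_sq [hL : Fact (0 < L)] : rootVolume n L ^ 2 = L ^ n :=
  Real.sq_sqrt (pow_pos hL.out n).le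

/-- The normalized monomials in `L²(𝕋ⁿ)`. -/
def monomialLp (L : ℝ) [Fact (0 < L)] (k : Fin n → ℤ) : TorusL2 n L :=
  ((rootVolume n L : ℂ)⁻¹) • ContinuousMap.toLp (E := ℂ) 2 volume ℂ (monomial L k)

theorem orthonormal_monomialLp [Fact (0 < L)] : Orthonormal ℂ (monomialLp (n := n) L) := by
  classical
  have h0 : (rootVolume n L : ℂ) ≠ 0 := by exact_mod_cast rootVolume_pos.ne'
  rw [orthonormal_iff_ite]
  intro k l
  rw [monomialLp, monomialLp, inner_smul_left, inner_smul_right, ContinuousMap.inner_toLp]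
  simp only [← monomial_neg, ← monomial_add, integral_monomial, map_inv₀, Complex.conj_ofReal]
  have h1 : l + -k = 0 ↔ k = l := by rw [add_neg_eq_zero, eq_comm]
  simp only [h1]
  split_ifs with h
  · have : (L : ℂ) ^ n = (rootVolume n L : ℂ) ^ 2 := by exact_mod_cast rootVolume_sq.symm
    rw [this]
    field_simp
  · simp

theorem span_monomialLp_closure_eq_top [Fact (0 < L)] :
    (Submodule.span ℂ (Set.range (monomialLp (n := n) L))).topologicalClosure = ⊤ := by
  have h0 : (rootVolume n L : ℂ) ≠ 0 := by exact_mod_cast rootVolume_pos.ne'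
  have h1 := (ContinuousMap.toLp_denseRange (α := Torus n L) (p := 2) ℂ volume ℂ
    (by simp)).topologicalClosure_map_submodule span_monomial_closure_eq_top
  rw [Submodule.map_span, ← Set.range_comp] at h1
  rw [eq_top_iff, ← h1]
  refine Submodule.topologicalClosure_mono (Submodule.span_le.2 ?_)
  rintro _ ⟨k, rfl⟩
  have h2 : ContinuousMap.toLp (E := ℂ) 2 volume ℂ (monomial L k) =
      (rootVolume n L : ℂ) • monomialLp L k := by
    rw [monomialLp, smul_inv_smul₀ h0]
  change ContinuousMap.toLp (E := ℂ) 2 volume ℂ (monomial L k) ∈ _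
  rw [h2]
  exact Submodule.smul_mem _ _ (Submodule.subset_span ⟨k, rfl⟩)

/-- The Fourier basis of `L²(𝕋ⁿ)`. -/
def fourierBasis (n : ℕ) (L : ℝ) [Fact (0 < L)] : HilbertBasis (Fin n → ℤ) ℂ (TorusL2 n L) :=
  HilbertBasis.mk orthonormal_monomialLp span_monomialLp_closure_eq_top.ge

theorem fourierBasis_apply [Fact (0 < L)] (k : Fin n → ℤ) :
    fourierBasis n L k = monomialLp L k := by
  rw [fourierBasis, HilbertBasis.coe_mk]

/-- The weak formulation pairs bilinearly, without conjugation; conjugating the test function turns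
that pairing into an inner product. -/
theorem inner_toLp_star [Fact (0 < L)] (φ : C(Torus n L, ℂ)) (ψ : TorusL2 n L) :
    ⟪ContinuousMap.toLp (E := ℂ) 2 volume ℂ (star φ), ψ⟫_ℂ = ∫ x, ψ x * φ x := by
  rw [L2.inner_def]
  refine integral_congr_ae ?_
  filter_upwards [ContinuousMap.coeFn_toLp (p := 2) (𝕜 := ℂ) volume (star φ)] with x hx
  rw [hx]
  simp

theorem inner_fourierBasis [Fact (0 < L)] (k : Fin n → ℤ) (ψ : TorusL2 n L) :
    ⟪fourierBasis n L k, ψ⟫_ℂ =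
      (rootVolume n L : ℂ)⁻¹ * ∫ x, ψ x * monomial L (-k) x := by
  have h1 : monomial L k = star (monomial L (-k)) := by
    ext x
    simp [monomial_neg]
  rw [fourierBasis_apply, monomialLp, inner_smul_left, h1, inner_toLp_star]
  simp

theorem inner_toLp_star_fourierBasis [Fact (0 < L)] (φ : C(Torus n L, ℂ)) (k : Fin n → ℤ) :
    ⟪ContinuousMap.toLp (E := ℂ) 2 volume ℂ (star φ), fourierBasis n L k⟫_ℂ =
      (rootVolume n L : ℂ)⁻¹ * ∫ x, φ x * monomial L k x := by
  rw [fourierBasis_apply, monomialLp, inner_smul_right, inner_toLp_star]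
  congr 1
  refine integral_congr_ae ?_
  filter_upwards [ContinuousMap.coeFn_toLp (p := 2) (𝕜 := ℂ) volume (monomial L k)] with x hx
  rw [hx, mul_comm]

/-- Continuous functions on the torus are integrable. -/
theorem integrable_of_continuous [Fact (0 < L)] {φ : Torus n L → ℂ} (hφ : Continuous φ) :
    Integrable φ :=
  hφ.integrable_of_hasCompactSupport (HasCompactSupport.of_compactSpace φ)

/-- Integration by parts from translation invariance: moving the shift `t` from `f` to the monomial
produces a phase in `t`, and the two expressions for the integral are differentiated at `t = 0`. -/
theorem integral_partialDeriv_mul_monomial_step [Fact (0 < L)] {f : Torus n L → ℂ}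
    (hf : TorusSmooth f) (l : ℕ) (j : Fin n) (k : Fin n → ℤ) :
    ∫ x, partialDeriv (l + 1) j f x * monomial L k x =
      -(2 * Real.pi * Complex.I * k j / L) * ∫ x, partialDeriv l j f x * monomial L k x := by
  have hc : ∀ l, Continuous (partialDeriv l j f) := fun l =>
    continuous_of_torusSmooth (torusSmooth_partialDeriv hf l j)
  have hadd : ∀ t : ℝ, Continuous fun x : Torus n L => x + Pi.single j (t : AddCircle L) :=
    fun t => continuous_id.add continuous_const
  let F : ℝ → Torus n L → ℂ := fun t x =>
    partialDeriv l j f (x + Pi.single j (t : AddCircle L)) * monomial L k x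
  let F' : ℝ → Torus n L → ℂ := fun t x =>
    partialDeriv (l + 1) j f (x + Pi.single j (t : AddCircle L)) * monomial L k x
  have hF : ∀ t, Continuous (F t) := fun t =>
    ((hc l).comp (hadd t)).mul (monomial L k).continuous
  have hF' : ∀ t, Continuous (F' t) := fun t =>
    ((hc (l + 1)).comp (hadd t)).mul (monomial L k).continuous
  obtain ⟨B, hB⟩ := isCompact_univ.exists_bound_of_continuousOn (hc (l + 1)).continuousOn
  have h1 : HasDerivAt (fun t => ∫ x, F t x) (∫ x, F' 0 x) 0 := by
    refine (hasDerivAt_integral_of_dominated_loc_of_deriv_le (bound := fun _ => B)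
      Filter.univ_mem (.of_forall fun t => (hF t).aestronglyMeasurable)
      (integrable_of_continuous (hF 0)) (hF' 0).aestronglyMeasurable
      (.of_forall fun x t _ => ?_) (integrable_const B) (.of_forall fun x t _ => ?_)).2
    · simp only [F', norm_mul, norm_monomial_apply, mul_one]
      exact hB _ (Set.mem_univ _)
    · exact (hf.hasDerivAt_partialDeriv l j x t).mul_const _
  have h2 : ∀ t : ℝ, ∫ x, F t x = Complex.exp (2 * Real.pi * Complex.I * k j / L * (-t : ℝ)) *
      ∫ x, partialDeriv l j f x * monomial L k x := by
    intro t
    rw [← integral_add_right_eq_self _ (Pi.single j ((-t : ℝ) : AddCircle L)),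
      ← integral_const_mul]
    refine integral_congr_ae (.of_forall fun x => ?_)
    simp only [F]
    rw [monomial_add_single, add_assoc, ← Pi.single_add, ← AddCircle.coe_add, neg_add_cancel]
    simp only [AddCircle.coe_zero, Pi.single_zero, add_zero]
    ring
  have h3 : HasDerivAt (fun t => ∫ x, F t x)
      (-(2 * Real.pi * Complex.I * k j / L) * ∫ x, partialDeriv l j f x * monomial L k x) 0 := by
    simp only [h2]
    refine HasDerivAt.mul_const ?_ _
    set a := 2 * Real.pi * Complex.I * k j / L
    have h4 : HasDerivAt (fun t : ℝ => a * ((-t : ℝ) : ℂ)) (-a) 0 := by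
      simpa using ((hasDerivAt_id (0 : ℝ)).neg.ofReal_comp.const_mul a)
    simpa using h4.cexp
  have h5 := h1.unique h3
  simpa [F'] using h5

theorem integral_partialDeriv_mul_monomial [Fact (0 < L)] {f : Torus n L → ℂ}
    (hf : TorusSmooth f) (l : ℕ) (j : Fin n) (k : Fin n → ℤ) :
    ∫ x, partialDeriv l j f x * monomial L k x =
      (-(2 * Real.pi * Complex.I * k j / L)) ^ l * ∫ x, f x * monomial L k x := by
  induction l with
  | zero => simp [partialDeriv_zero]
  | succ l ih => rw [integral_partialDeriv_mul_monomial_step hf, ih, pow_succ']; ring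

/-- The eigenvalues of `-Δ`. -/
def eigenvalue (L : ℝ) (k : Fin n → ℤ) : ℝ := 4 * Real.pi ^ 2 * (∑ i, (k i : ℝ) ^ 2) / L ^ 2

theorem eigenvalue_nonneg (k : Fin n → ℤ) : 0 ≤ eigenvalue L k := by
  unfold eigenvalue
  positivity

theorem eigenvalue_neg (k : Fin n → ℤ) : eigenvalue L (-k) = eigenvalue L k := by
  simp [eigenvalue]

theorem sum_sq_eq_neg_eigenvalue (k : Fin n → ℤ) :
    ∑ j, (2 * Real.pi * Complex.I * k j / L) ^ 2 = -(eigenvalue L k : ℂ) := by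
  simp only [eigenvalue, div_pow, mul_pow, Complex.I_sq]
  push_cast
  rw [Finset.mul_sum, Finset.sum_div, ← Finset.sum_neg_distrib]
  refine Finset.sum_congr rfl fun j _ => ?_
  ring

theorem partialDeriv_monomial (l : ℕ) (j : Fin n) (k : Fin n → ℤ) (x : Torus n L) :
    partialDeriv l j (monomial L k) x =
      (2 * Real.pi * Complex.I * k j / L) ^ l * monomial L k x := by
  induction l generalizing x with
  | zero => simp [partialDeriv_zero]
  | succ l ih =>
    have h1 := (torusSmooth_monomial (L := L) k).hasDerivAt_partialDeriv l j x 0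
    have h2 := (hasDerivAt_monomial_line (L := L) k j x 0).const_mul
      ((2 * Real.pi * Complex.I * k j / L) ^ l)
    simp only [ih] at h1
    have h3 := h1.unique h2
    simp only [AddCircle.coe_zero, Pi.single_zero, add_zero] at h3
    rw [h3]
    ring

theorem torusLaplacian_monomial (k : Fin n → ℤ) (x : Torus n L) :
    torusLaplacian (monomial L k) x = -(eigenvalue L k : ℂ) * monomial L k x := by
  simp only [torusLaplacian, partialDeriv_monomial]
  rw [← Finset.sum_mul, sum_sq_eq_neg_eigenvalue]

theorem integral_torusLaplacian_mul_monomial [Fact (0 < L)] {f : Torus n L → ℂ}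
    (hf : TorusSmooth f) (k : Fin n → ℤ) :
    ∫ x, torusLaplacian f x * monomial L k x =
      -(eigenvalue L k : ℂ) * ∫ x, f x * monomial L k x := by
  simp only [torusLaplacian, Finset.sum_mul]
  rw [integral_finsetSum]
  · simp only [integral_partialDeriv_mul_monomial hf, neg_sq]
    rw [← Finset.sum_mul, sum_sq_eq_neg_eigenvalue]
  · intro j _
    exact integrable_of_continuous ((continuous_of_torusSmooth
      (torusSmooth_partialDeriv hf 2 j)).mul (monomial L k).continuous)

end Torus

/-! ### The Schrödinger operator in the Fourier basis -/

section Schrodinger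

variable {n : ℕ} {L : ℝ} [Fact (0 < L)]

theorem memLp_mul_torusL2 (V : C(Torus n L, ℝ)) (ψ : TorusL2 n L) :
    MemLp (fun x => (V x : ℂ) * ψ x) 2 volume := by
  obtain ⟨B, hB⟩ := isCompact_univ.exists_bound_of_continuousOn V.continuous.continuousOn
  refine (Lp.memLp ψ).of_le_mul (c := B)
    ((Complex.continuous_ofReal.comp V.continuous).aestronglyMeasurable.mul
      (Lp.aestronglyMeasurable ψ)) (.of_forall fun x => ?_)
  rw [norm_mul, Complex.norm_real]
  exact mul_le_mul_of_nonneg_right (hB x (Set.mem_univ x)) (norm_nonneg _)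

/-- Multiplication by `V` on `L²(𝕋ⁿ)`. -/
def torusPotential (V : C(Torus n L, ℝ)) : TorusL2 n L →ₗ[ℂ] TorusL2 n L where
  toFun ψ := (memLp_mul_torusL2 V ψ).toLp
  map_add' ψ φ := by
    rw [← MemLp.toLp_add]
    refine MemLp.toLp_congr _ _ ?_
    filter_upwards [Lp.coeFn_add ψ φ] with x hx
    rw [hx, Pi.add_apply, Pi.add_apply, mul_add]
  map_smul' c ψ := by
    rw [RingHom.id_apply, ← MemLp.toLp_const_smul]
    refine MemLp.toLp_congr _ _ ?_
    filter_upwards [Lp.coeFn_smul c ψ] with x hx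
    rw [hx, Pi.smul_apply, Pi.smul_apply, smul_eq_mul, smul_eq_mul, mul_left_comm]

theorem coeFn_torusPotential (V : C(Torus n L, ℝ)) (ψ : TorusL2 n L) :
    torusPotential V ψ =ᵐ[volume] fun x => (V x : ℂ) * ψ x :=
  MemLp.coeFn_toLp (memLp_mul_torusL2 V ψ)

theorem isSymmetric_torusPotential (V : C(Torus n L, ℝ)) : (torusPotential V).IsSymmetric := by
  intro ψ φ
  rw [L2.inner_def, L2.inner_def]
  refine integral_congr_ae ?_
  filter_upwards [coeFn_torusPotential V ψ, coeFn_torusPotential V φ] with x h1 h2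
  rw [h1, h2]
  simp only [RCLike.inner_apply, map_mul, Complex.conj_ofReal]
  ring

theorem inner_torusPotential_self (V : C(Torus n L, ℝ)) (ψ : TorusL2 n L) :
    ⟪ψ, torusPotential V ψ⟫_ℂ = ((∫ x, V x * ‖ψ x‖ ^ 2 : ℝ) : ℂ) := by
  rw [L2.inner_def]
  refine Eq.trans (integral_congr_ae ?_) integral_complex_ofReal
  filter_upwards [coeFn_torusPotential V ψ] with x h1
  rw [h1]
  simp only [RCLike.inner_apply, mul_assoc, Complex.mul_conj']
  norm_cast

theorem inner_torusPotential_nonneg {V : C(Torus n L, ℝ)} (hV : ∀ x, 0 ≤ V x) (ψ : TorusL2 n L) :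
    0 ≤ (⟪ψ, torusPotential V ψ⟫_ℂ).re := by
  rw [inner_torusPotential_self, Complex.ofReal_re]
  exact integral_nonneg fun x => mul_nonneg (hV x) (by positivity)

theorem norm_torusPotential_le {V : C(Torus n L, ℝ)} {M : ℝ} (hV : ∀ x, |V x| ≤ M)
    (ψ : TorusL2 n L) : ‖torusPotential V ψ‖ ≤ M * ‖ψ‖ := by
  refine Lp.norm_le_mul_norm_of_ae_le_mul ?_
  filter_upwards [coeFn_torusPotential V ψ] with x hx
  rw [hx, norm_mul, Complex.norm_real]
  exact mul_le_mul_of_nonneg_right (hV x) (norm_nonneg _)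

/-- Monomials as test functions give the coefficient relation. Conversely, Parseval expands an
arbitrary test function, whose Laplacian has coefficients multiplied by minus the eigenvalue. -/
theorem mem_schrodingerGraph_iff (V : C(Torus n L, ℝ)) (ψ g : TorusL2 n L) :
    (ψ, g) ∈ schrodingerGraph V ↔ ∀ k, ⟪Torus.fourierBasis n L k, g⟫_ℂ =
      Torus.eigenvalue L k * ⟪Torus.fourierBasis n L k, ψ⟫_ℂ +
        ⟪Torus.fourierBasis n L k, torusPotential V ψ⟫_ℂ := by
  have hV : ∀ φ : C(Torus n L, ℂ), ∫ x, torusPotential V ψ x * φ x = ∫ x, ψ x * (V x * φ x) := by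
    intro φ
    refine integral_congr_ae ?_
    filter_upwards [coeFn_torusPotential V ψ] with x hx
    rw [hx]
    ring
  have hVc : ∀ φ : C(Torus n L, ℂ), Continuous fun x => (V x : ℂ) * φ x := fun φ =>
    (Complex.continuous_ofReal.comp V.continuous).mul φ.continuous
  constructor
  · intro h k
    have h1 := h _ (Torus.torusSmooth_monomial (-k))
    simp only [mul_add] at h1
    simp only [Torus.torusLaplacian_monomial, neg_mul, neg_neg, Torus.eigenvalue_neg] at h1
    rw [integral_add (integrable_torusL2_mul ψ (by fun_prop))
      (integrable_torusL2_mul ψ (hVc _)), ← hV] at h1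
    simp only [mul_left_comm _ (Torus.eigenvalue L k : ℂ)] at h1
    rw [integral_const_mul] at h1
    simp only [Torus.inner_fourierBasis]
    rw [h1]
    ring
  · intro h φ hφ
    have hφc := continuous_of_torusSmooth hφ
    have hΔc := continuous_of_torusSmooth (torusSmooth_torusLaplacian hφ)
    let f : C(Torus n L, ℂ) := ⟨φ, hφc⟩
    let d : C(Torus n L, ℂ) := ⟨torusLaplacian φ, hΔc⟩
    let b := Torus.fourierBasis n L
    have h1 := b.hasSum_inner_mul_inner (ContinuousMap.toLp (E := ℂ) 2 volume ℂ (star f)) g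
    have h2 := b.hasSum_inner_mul_inner (ContinuousMap.toLp (E := ℂ) 2 volume ℂ (star d)) ψ
    have h3 := b.hasSum_inner_mul_inner (ContinuousMap.toLp (E := ℂ) 2 volume ℂ (star f))
      (torusPotential V ψ)
    have h4 : ∀ k, ⟪ContinuousMap.toLp (E := ℂ) 2 volume ℂ (star d), b k⟫_ℂ =
        -(Torus.eigenvalue L k : ℂ) *
          ⟪ContinuousMap.toLp (E := ℂ) 2 volume ℂ (star f), b k⟫_ℂ := by
      intro k
      simp only [b, Torus.inner_toLp_star_fourierBasis]
      have := Torus.integral_torusLaplacian_mul_monomial hφ k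
      simp only [d, f, ContinuousMap.coe_mk]
      rw [this]
      ring
    have h5 := h1.unique (a₂ := -⟪ContinuousMap.toLp (E := ℂ) 2 volume ℂ (star d), ψ⟫_ℂ +
      ⟪ContinuousMap.toLp (E := ℂ) 2 volume ℂ (star f), torusPotential V ψ⟫_ℂ) (by
        refine HasSum.congr_fun (h2.neg.add h3) fun k => ?_
        rw [h4, h k]
        ring)
    simp only [Torus.inner_toLp_star] at h5
    simp only [mul_add]
    rw [integral_add (integrable_torusL2_mul ψ (φ := fun x => -torusLaplacian φ x) hΔc.neg) (integrable_torusL2_mul ψ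
      (φ := fun x => (V x : ℂ) * φ x) (hVc f))]
    simp only [mul_neg]
    rw [integral_neg]
    exact h5.trans (congrArg _ (hV f))

theorem isDiagonalAdd_torusSchrodinger (V : C(Torus n L, ℝ)) :
    IsDiagonalAdd (torusSchrodinger V) (Torus.fourierBasis n L) (Torus.eigenvalue L)
      (torusPotential V) := by
  -- The weak graph is single-valued, so passing to `toLinearPMap` does not change it.
  have hg : ∀ p : TorusL2 n L × TorusL2 n L, p ∈ schrodingerGraph V → p.1 = 0 → p.2 = 0 := by
    rintro ⟨ψ, g⟩ hp rfl
    rw [mem_schrodingerGraph_iff] at hp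
    exact (Torus.fourierBasis n L).ext_inner fun k => by rw [hp k]; simp
  intro ψ g
  rw [torusSchrodinger, Submodule.toLinearPMap_graph_eq _ hg, mem_schrodingerGraph_iff]

end Schrodinger

/-! ### The grid Hamiltonian in the discrete Fourier basis -/

section GridBasis

variable {n N : ℕ}

theorem exp_two_pi_mul_I_div_eq_one_iff (hN : 0 < N) (q : ℤ) :
    Complex.exp (2 * Real.pi * Complex.I * q / N) = 1 ↔ (N : ℤ) ∣ q := by
  have hN' : (N : ℂ) ≠ 0 := by exact_mod_cast hN.ne'
  have hpi := Complex.two_pi_I_ne_zero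
  rw [Complex.exp_eq_one_iff]
  constructor
  · rintro ⟨m, hm⟩
    refine ⟨m, ?_⟩
    field_simp at hm
    have : (q : ℂ) = (N : ℂ) * m := by rw [hm]
    exact_mod_cast this
  · rintro ⟨m, rfl⟩
    refine ⟨m, ?_⟩
    push_cast
    field_simp

theorem sum_gridLabel_exp (hN : 0 < N) (hNe : Even N) (q : ℤ) :
    ∑ y : GridLabel N, Complex.exp (2 * Real.pi * Complex.I * q * ((y : ℤ) : ℂ) / N) =
      if (N : ℤ) ∣ q then (N : ℂ) else 0 := by
  obtain ⟨m, rfl⟩ := hNe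
  set z := Complex.exp (2 * Real.pi * Complex.I * q / (m + m : ℕ)) with hz
  have hz0 : z ≠ 0 := Complex.exp_ne_zero _
  have h1 : ∀ y : ℤ, Complex.exp (2 * Real.pi * Complex.I * q * (y : ℂ) / (m + m : ℕ)) = z ^ y := by
    intro y
    rw [hz, ← Complex.exp_int_mul]
    congr 1
    ring
  simp only [h1]
  rw [Finset.sum_coe_sort (Finset.Ico (-(((m + m : ℕ) : ℤ) / 2)) (((m + m : ℕ) : ℤ) / 2))
    (fun y : ℤ => z ^ y)]
  have h2 : ((m + m : ℕ) : ℤ) / 2 = m := by omega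
  -- Labels start at `-m`; shifting by `m` leaves a geometric sum over a full period.
  have h3 : ∑ y ∈ Finset.Ico (-(m : ℤ)) m, z ^ y =
      z ^ (-(m : ℤ)) * ∑ i ∈ Finset.range (m + m), z ^ i := by
    rw [Finset.mul_sum]
    symm
    refine Finset.sum_nbij' (fun i => (i : ℤ) - m) (fun y => (y + m).toNat) ?_ ?_ ?_ ?_ ?_
    · intro i hi
      simp only [Finset.mem_range, Finset.mem_Ico] at *
      omega
    · intro y hy
      simp only [Finset.mem_range, Finset.mem_Ico] at *
      omega
    · intro i hi
      simp
    · intro y hy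
      simp only [Finset.mem_Ico] at hy
      omega
    · intro i hi
      rw [← zpow_natCast, ← zpow_add₀ hz0]
      congr 1
      ring
  rw [h2, h3]
  have h4 := exp_two_pi_mul_I_div_eq_one_iff hN q
  rw [← hz] at h4
  split_ifs with hq
  · rw [h4.2 hq]
    simp
  · have h5 : z ^ (m + m) = 1 := by
      have := h1 ((m + m : ℕ) : ℤ)
      rw [zpow_natCast] at this
      rw [← this]
      have h6 : ((m + m : ℕ) : ℂ) ≠ 0 := by exact_mod_cast hN.ne'
      rw [Int.cast_natCast, mul_div_assoc, div_self h6, mul_one, mul_comm]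
      exact Complex.exp_int_mul_two_pi_mul_I q
    rw [geom_sum_eq (fun h => hq (h4.1 h)), h5]
    simp

theorem conj_gridFourier_mul (y k l : Grid n N) :
    (starRingEnd ℂ) (gridFourier n N y k) * gridFourier n N y l =
      ∏ i, ((N : ℂ)⁻¹ * Complex.exp (2 * Real.pi * Complex.I * (((l i : ℤ) - (k i : ℤ) : ℤ) : ℂ) *
        ((y i : ℤ) : ℂ) / N)) := by
  have h0 : ((1 / Real.sqrt N : ℝ) : ℂ) * ((1 / Real.sqrt N : ℝ) : ℂ) = (N : ℂ)⁻¹ := by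
    rw [← Complex.ofReal_mul, div_mul_div_comm, Real.mul_self_sqrt (Nat.cast_nonneg N)]
    push_cast
    simp
  simp only [gridFourier, Matrix.of_apply, map_prod, ← Finset.prod_mul_distrib]
  refine Finset.prod_congr rfl fun i _ => ?_
  rw [map_mul, Complex.conj_ofReal, mul_mul_mul_comm, h0, ← Complex.exp_conj, ← Complex.exp_add]
  congr 2
  simp only [map_div₀, map_mul, Complex.conj_I, Complex.conj_ofReal, map_ofNat, map_intCast,
    map_natCast]
  push_cast
  ring

theorem gridLabel_dvd_sub_iff (k l : GridLabel N) : (N : ℤ) ∣ (l : ℤ) - k ↔ k = l := by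
  have hk := Finset.mem_Ico.1 k.2
  have hl := Finset.mem_Ico.1 l.2
  constructor
  · intro h
    have h1 : (l : ℤ) - k = 0 := by
      refine Int.eq_zero_of_abs_lt_dvd h ?_
      rw [abs_lt]
      omega
    exact Subtype.ext (by omega)
  · rintro rfl
    simp

/-- The sum over the grid factors into one sum of roots of unity per coordinate, and distinct labels
are incongruent modulo `N`. -/
theorem conjTranspose_gridFourier_mul (hN : 0 < N) (hNe : Even N) :
    (gridFourier n N).conjTranspose * gridFourier n N = 1 := by
  classical
  have hN' : (N : ℂ) ≠ 0 := by exact_mod_cast hN.ne'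
  ext k l
  rw [Matrix.mul_apply]
  simp only [Matrix.conjTranspose_apply, RCLike.star_def, conj_gridFourier_mul]
  rw [← Fintype.prod_sum (fun (i : Fin n) (y : GridLabel N) => (N : ℂ)⁻¹ *
    Complex.exp (2 * Real.pi * Complex.I * (((l i : ℤ) - (k i : ℤ) : ℤ) : ℂ) * ((y : ℤ) : ℂ) / N))]
  simp only [← Finset.mul_sum, sum_gridLabel_exp hN hNe, gridLabel_dvd_sub_iff]
  by_cases h : k = l
  · subst h
    simp [hN']
  · rw [Matrix.one_apply_ne h]
    obtain ⟨i, hi⟩ := Function.ne_iff.1 h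
    exact Finset.prod_eq_zero (Finset.mem_univ i) (by simp [hi])

/-- The columns of the discrete Fourier transform. -/
def gridColumn (n N : ℕ) (k : Grid n N) : EuclideanSpace ℂ (Grid n N) :=
  WithLp.toLp 2 fun y => gridFourier n N y k

theorem inner_gridColumn (k : Grid n N) (x : EuclideanSpace ℂ (Grid n N)) :
    ⟪gridColumn n N k, x⟫_ℂ = ((gridFourier n N).conjTranspose.mulVec x) k := by
  rw [PiLp.inner_apply, Matrix.mulVec, dotProduct]
  refine Finset.sum_congr rfl fun y _ => ?_
  simp [gridColumn, mul_comm]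

theorem orthonormal_gridColumn (hN : 0 < N) (hNe : Even N) : Orthonormal ℂ (gridColumn n N) := by
  classical
  rw [orthonormal_iff_ite]
  intro k l
  rw [inner_gridColumn]
  have := congrFun (congrFun (conjTranspose_gridFourier_mul (n := n) hN hNe) k) l
  rw [Matrix.one_apply] at this
  rw [← this]
  rfl

/-- The basis of columns of the discrete Fourier transform. -/
def gridBasis (hN : 0 < N) (hNe : Even N) :
    HilbertBasis (Grid n N) ℂ (EuclideanSpace ℂ (Grid n N)) :=
  HilbertBasis.mk (orthonormal_gridColumn hN hNe) (by
    rw [(orthonormal_gridColumn hN hNe).linearIndependent.span_eq_top_of_card_eq_finrank'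
      (by simp)]
    exact Submodule.le_topologicalClosure _)

theorem gridBasis_apply (hN : 0 < N) (hNe : Even N) (k : Grid n N) :
    gridBasis hN hNe k = gridColumn n N k := by
  rw [gridBasis, HilbertBasis.coe_mk]

theorem inner_gridColumn_gridKinetic (hN : 0 < N) (hNe : Even N) (L : ℝ) (k : Grid n N)
    (x : EuclideanSpace ℂ (Grid n N)) :
    ⟪gridColumn n N k, Matrix.toEuclideanLin (gridKinetic n N L) x⟫_ℂ =
      Torus.eigenvalue L (fun i => (k i : ℤ)) * ⟪gridColumn n N k, x⟫_ℂ := by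
  rw [inner_gridColumn, inner_gridColumn, Matrix.ofLp_toLpLin, Matrix.toLin'_apply, Matrix.mulVec_mulVec,
    gridKinetic, ← Matrix.mul_assoc, ← Matrix.mul_assoc, conjTranspose_gridFourier_mul hN hNe,
    Matrix.one_mul, ← Matrix.mulVec_mulVec, Matrix.mulVec_diagonal]
  rfl

variable {L : ℝ}

theorem gridPotential_apply (V : Torus n L → ℝ) (x : EuclideanSpace ℂ (Grid n N)) (y : Grid n N) :
    Matrix.toEuclideanLin (gridPotential N V) x y =
      (V (Torus.mk L (fun i => ((y i : ℤ) : ℝ) * L / N)) : ℂ) * x y := by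
  rw [Matrix.ofLp_toLpLin, Matrix.toLin'_apply, gridPotential, Matrix.mulVec_diagonal]

theorem isSymmetric_gridPotential (V : Torus n L → ℝ) :
    (Matrix.toEuclideanLin (gridPotential N V)).IsSymmetric := by
  intro x z
  simp only [PiLp.inner_apply, gridPotential_apply, RCLike.inner_apply, map_mul,
    Complex.conj_ofReal]
  exact Finset.sum_congr rfl fun y _ => by ring

theorem inner_gridPotential_self (V : Torus n L → ℝ) (x : EuclideanSpace ℂ (Grid n N)) :
    ⟪x, Matrix.toEuclideanLin (gridPotential N V) x⟫_ℂ =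
      ((∑ y : Grid n N, V (Torus.mk L (fun i => ((y i : ℤ) : ℝ) * L / N)) * ‖x y‖ ^ 2 : ℝ) : ℂ) := by
  simp only [PiLp.inner_apply, gridPotential_apply, RCLike.inner_apply, mul_assoc,
    Complex.mul_conj']
  norm_cast

theorem inner_gridPotential_nonneg {V : Torus n L → ℝ} (hV : ∀ x, 0 ≤ V x)
    (x : EuclideanSpace ℂ (Grid n N)) :
    0 ≤ (⟪x, Matrix.toEuclideanLin (gridPotential N V) x⟫_ℂ).re := by
  rw [inner_gridPotential_self, Complex.ofReal_re]
  exact Finset.sum_nonneg fun y _ => mul_nonneg (hV _) (by positivity)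

theorem norm_gridPotential_le {V : Torus n L → ℝ} {M : ℝ} (hM : 0 ≤ M) (hV : ∀ x, |V x| ≤ M)
    (x : EuclideanSpace ℂ (Grid n N)) :
    ‖Matrix.toEuclideanLin (gridPotential N V) x‖ ≤ M * ‖x‖ := by
  rw [← sq_le_sq₀ (norm_nonneg _) (by positivity), mul_pow, EuclideanSpace.norm_sq_eq,
    EuclideanSpace.norm_sq_eq, Finset.mul_sum]
  refine Finset.sum_le_sum fun y _ => ?_
  rw [gridPotential_apply, norm_mul, mul_pow, Complex.norm_real, Real.norm_eq_abs]
  gcongr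
  exact hV _

theorem isDiagonalAdd_gridHamiltonian (hN : 0 < N) (hNe : Even N) (V : Torus n L → ℝ) :
    IsDiagonalAdd (gridHamiltonian N V) (gridBasis hN hNe)
      (fun k : Grid n N => Torus.eigenvalue L (fun i => (k i : ℤ)))
      (Matrix.toEuclideanLin (gridPotential N V)) := by
  have h1 : ∀ x k, ⟪gridBasis hN hNe k,
      Matrix.toEuclideanLin (gridKinetic n N L + gridPotential N V) x⟫_ℂ =
        Torus.eigenvalue L (fun i => (k i : ℤ)) * ⟪gridBasis hN hNe k, x⟫_ℂ +
          ⟪gridBasis hN hNe k, Matrix.toEuclideanLin (gridPotential N V) x⟫_ℂ := by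
    intro x k
    rw [map_add, LinearMap.add_apply, inner_add_right, gridBasis_apply,
      inner_gridColumn_gridKinetic hN hNe]
  intro x w
  have h2 : (x, w) ∈ (gridHamiltonian N V).graph ↔
      Matrix.toEuclideanLin (gridKinetic n N L + gridPotential N V) x = w := by
    rw [LinearPMap.mem_graph_iff]
    constructor
    · rintro ⟨y, hy, hw⟩
      exact (congrArg (Matrix.toEuclideanLin (gridKinetic n N L + gridPotential N V)) hy).symm.trans
        hw
    · intro hw
      exact ⟨⟨x, Submodule.mem_top⟩, rfl, hw⟩
  rw [h2]
  constructor
  · rintro rfl k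
    exact h1 x k
  · intro hw
    exact (gridBasis hN hNe).ext_inner fun k => by rw [h1, hw]

end GridBasis

/-! ### Lattice sums -/

section LatticeSum

/-- Up to `B` the terms are constant; beyond, `1 / m ^ 2 ≤ 2 / m - 2 / (m + 1)` telescopes. The
subtracted term makes the induction close. -/
theorem sum_range_inv_max_sq_le {B : ℕ} (hB : 0 < B) (M : ℕ) :
    ∑ m ∈ Finset.range M, 1 / (max (m : ℝ) B) ^ 2 ≤ 3 / (B : ℝ) - 2 / max (M : ℝ) B := by
  have hB' : (0 : ℝ) < B := by exact_mod_cast hB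
  rcases le_total M B with hM | hM
  · have hM' : (M : ℝ) ≤ B := by exact_mod_cast hM
    rw [max_eq_right hM', ← sub_div, Finset.sum_congr rfl (g := fun _ => 1 / (B : ℝ) ^ 2)]
    · rw [Finset.sum_const, Finset.card_range, nsmul_eq_mul, mul_one_div,
        div_le_div_iff₀ (by positivity) hB']
      nlinarith
    · intro m hm
      have : (m : ℝ) ≤ B := by exact_mod_cast (Finset.mem_range.1 hm).le.trans hM
      rw [max_eq_right this]
  · induction M, hM using Nat.le_induction with
    | base =>
      have h1 : ∑ m ∈ Finset.range B, 1 / (max (m : ℝ) B) ^ 2 = 1 / (B : ℝ) := by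
        rw [Finset.sum_congr rfl (g := fun _ => 1 / (B : ℝ) ^ 2)]
        · rw [Finset.sum_const, Finset.card_range, nsmul_eq_mul]
          field_simp
        · intro m hm
          have : (m : ℝ) ≤ B := by exact_mod_cast (Finset.mem_range.1 hm).le
          rw [max_eq_right this]
      rw [h1, max_self, ← sub_div]
      norm_num
    | succ M hM ih =>
      have hM' : (B : ℝ) ≤ M := by exact_mod_cast hM
      have hM1 : (1 : ℝ) ≤ M := by exact_mod_cast (hB.trans_le hM : 1 ≤ M)
      rw [Finset.sum_range_succ]
      rw [max_eq_left hM'] at ih ⊢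
      push_cast
      rw [max_eq_left (by linarith : (B : ℝ) ≤ M + 1)]
      have h1 : 1 / (M : ℝ) ^ 2 ≤ 2 / M - 2 / (M + 1) := by
        rw [div_sub_div _ _ (by positivity) (by positivity),
          div_le_div_iff₀ (by positivity) (by positivity)]
        nlinarith
      linarith

theorem sum_inv_max_abs_sq_le {B : ℕ} (hB : 0 < B) (T : Finset ℤ) :
    ∑ t ∈ T, 1 / (max |(t : ℝ)| B) ^ 2 ≤ 6 / (B : ℝ) := by
  have hB' : (0 : ℝ) < B := by exact_mod_cast hB
  set f : ℤ → ℝ := fun t => 1 / (max |(t : ℝ)| B) ^ 2 with hf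
  have hf0 : ∀ t, 0 ≤ f t := fun t => by positivity
  set M := T.sup Int.natAbs
  have hT : T ⊆ Finset.Icc (-(M : ℤ)) M := by
    intro t ht
    have : t.natAbs ≤ M := Finset.le_sup ht
    rw [Finset.mem_Icc]
    omega
  have heven : f.Even := fun t => by simp [hf]
  calc ∑ t ∈ T, f t ≤ ∑ t ∈ Finset.Icc (-(M : ℤ)) M, f t :=
        Finset.sum_le_sum_of_subset_of_nonneg hT fun t _ _ => hf0 t
    _ = 2 • ∑ m ∈ Finset.range (M + 1), f m - f 0 := Finset.sum_Icc_of_even_eq_range heven M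
    _ ≤ 2 * (3 / (B : ℝ)) := by
        have h1 := sum_range_inv_max_sq_le hB (M + 1)
        have h2 : ∑ m ∈ Finset.range (M + 1), f m =
            ∑ m ∈ Finset.range (M + 1), 1 / (max (m : ℝ) B) ^ 2 := by
          refine Finset.sum_congr rfl fun m _ => ?_
          simp [hf]
        have h3 : (0 : ℝ) ≤ 2 / max ((M + 1 : ℕ) : ℝ) B := by positivity
        have h4 := hf0 0
        rw [h2, two_nsmul]
        linarith
    _ = 6 / (B : ℝ) := by ring

/-- Enlarging `S` to the product of its coordinate projections makes the sum factor. -/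
theorem sum_prod_inv_max_abs_sq_le {n B : ℕ} (hB : 0 < B) (S : Finset (Fin n → ℤ)) :
    ∑ q ∈ S, ∏ i, 1 / (max |(q i : ℝ)| B) ^ 2 ≤ (6 / (B : ℝ)) ^ n := by
  have hB' : (0 : ℝ) < B := by exact_mod_cast hB
  have hS : S ⊆ Fintype.piFinset fun i => S.image fun q : Fin n → ℤ => q i := by
    intro q hq
    rw [Fintype.mem_piFinset]
    exact fun i => Finset.mem_image_of_mem _ hq
  calc ∑ q ∈ S, ∏ i, 1 / (max |(q i : ℝ)| B) ^ 2
      ≤ ∑ q ∈ Fintype.piFinset fun i => S.image fun q : Fin n → ℤ => q i,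
          ∏ i, 1 / (max |(q i : ℝ)| B) ^ 2 :=
        Finset.sum_le_sum_of_subset_of_nonneg hS fun q _ _ =>
          Finset.prod_nonneg fun i _ => by positivity
    _ = ∏ i, ∑ t ∈ S.image fun q : Fin n → ℤ => q i, 1 / (max |(t : ℝ)| B) ^ 2 :=
        (Finset.prod_univ_sum _ fun _ (t : ℤ) => 1 / (max |(t : ℝ)| B) ^ 2).symm
    _ ≤ ∏ _i : Fin n, (6 / (B : ℝ)) :=
        Finset.prod_le_prod (fun i _ => Finset.sum_nonneg fun t _ => by positivity)
          fun i _ => sum_inv_max_abs_sq_le hB _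
    _ = (6 / (B : ℝ)) ^ n := by rw [Finset.prod_const, Finset.card_univ, Fintype.card_fin]

theorem summable_prod_inv_max_abs_sq {n B : ℕ} (hB : 0 < B) :
    Summable fun q : Fin n → ℤ => ∏ i, 1 / (max |(q i : ℝ)| B) ^ 2 :=
  summable_of_sum_le (fun q => Finset.prod_nonneg fun i _ => by positivity)
    (fun S => sum_prod_inv_max_abs_sq_le hB S)

end LatticeSum

/-! ### Trigonometric approximation of smooth functions -/

namespace Torus

variable {n : ℕ} {L : ℝ}

/-- The Fourier coefficients of a function on the torus. -/
def coeff [Fact (0 < L)] (f : Torus n L → ℂ) (q : Fin n → ℤ) : ℂ :=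
  ((L : ℂ) ^ n)⁻¹ * ∫ x, f x * monomial L (-q) x

/-- The frequencies with coordinates in `[-B, B]`. -/
def box (n B : ℕ) : Finset (Fin n → ℤ) := Fintype.piFinset fun _ => Finset.Icc (-(B : ℤ)) B

theorem mem_box {B : ℕ} {q : Fin n → ℤ} : q ∈ box n B ↔ ∀ i, |q i| ≤ B := by
  simp [box, abs_le]

theorem volume_real_univ [hL : Fact (0 < L)] :
    (volume : Measure (Torus n L)).real Set.univ = L ^ n := by
  have h1 := integral_monomial (n := n) (L := L) 0
  rw [monomial_zero, if_pos rfl] at h1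
  simp only [ContinuousMap.one_apply, integral_const, Complex.real_smul, mul_one] at h1
  exact_mod_cast h1

theorem norm_coeff_le [hL : Fact (0 < L)] {f : Torus n L → ℂ} (hf : TorusSmooth f) {l : ℕ} {D : ℝ}
    {j : Fin n} (hD : ∀ x, ‖partialDeriv l j f x‖ ≤ D) {q : Fin n → ℤ} (hq : q j ≠ 0) :
    ‖coeff f q‖ ≤ D * (L / (2 * Real.pi * |(q j : ℝ)|)) ^ l := by
  have hLn : 0 < L ^ n := pow_pos hL.out n
  have hL0 := hL.out
  have hq' : 0 < |(q j : ℝ)| := abs_pos.2 (by exact_mod_cast hq)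
  have h1 : ‖∫ x, partialDeriv l j f x * monomial L (-q) x‖ ≤ D * L ^ n := by
    rw [← volume_real_univ]
    refine norm_integral_le_of_norm_le_const (.of_forall fun x => ?_)
    rw [norm_mul, norm_monomial_apply, mul_one]
    exact hD x
  rw [integral_partialDeriv_mul_monomial hf, norm_mul, norm_pow] at h1
  have h2 : ‖-(2 * Real.pi * Complex.I * ((-q) j : ℤ) / L)‖ = 2 * Real.pi * |(q j : ℝ)| / L := by
    rw [norm_neg, norm_div, norm_mul, norm_mul, norm_mul, Complex.norm_I, Complex.norm_real,
      Complex.norm_real, Complex.norm_intCast, Real.norm_of_nonneg Real.pi_pos.le,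
      Real.norm_of_nonneg hL0.le]
    simp
  rw [h2] at h1
  have h3 : ‖coeff f q‖ = (L ^ n)⁻¹ * ‖∫ x, f x * monomial L (-q) x‖ := by
    rw [coeff, norm_mul, norm_inv, norm_pow, Complex.norm_real, Real.norm_of_nonneg hL0.le]
  rw [h3, inv_mul_le_iff₀ hLn]
  have h4 : (L / (2 * Real.pi * |(q j : ℝ)|)) ^ l = ((2 * Real.pi * |(q j : ℝ)| / L) ^ l)⁻¹ := by
    rw [← inv_pow, inv_div]
  have h5 : 0 < (2 * Real.pi * |(q j : ℝ)| / L) ^ l := by positivity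
  rw [h4, ← mul_assoc, ← div_eq_mul_inv, le_div_iff₀ h5]
  linarith

/-- If the Fourier coefficients are summable, then the Fourier series converges uniformly. -/
theorem hasSum_fourier [hL : Fact (0 < L)] (f : C(Torus n L, ℂ)) (hf : Summable (coeff f)) :
    HasSum (fun q => coeff f q • monomial L q) f := by
  have h0 : (rootVolume n L : ℂ) ≠ 0 := by exact_mod_cast rootVolume_pos.ne'
  have hv : (L : ℂ) ^ n = (rootVolume n L : ℂ) ^ 2 := by exact_mod_cast rootVolume_sq.symm
  refine ContinuousMap.hasSum_of_hasSum_Lp (p := 2) (𝕜 := ℂ) (μ := volume) (.of_norm ?_) ?_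
  · refine hf.norm.of_nonneg_of_le (fun q => norm_nonneg _) fun q => ?_
    rw [norm_smul]
    have h1 : ‖monomial L q‖ ≤ 1 :=
      (ContinuousMap.norm_le _ zero_le_one).2 fun x => (norm_monomial_apply q x).le
    exact mul_le_of_le_one_right (norm_nonneg (coeff f q)) h1
  · refine HasSum.congr_fun ((fourierBasis n L).hasSum_repr
      (ContinuousMap.toLp (E := ℂ) 2 volume ℂ f)) fun q => ?_
    rw [HilbertBasis.repr_apply_apply, inner_fourierBasis, fourierBasis_apply, monomialLp,
      smul_smul, Function.comp_apply, map_smul, coeff, hv]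
    congr 1
    have h1 : ∫ x, ContinuousMap.toLp (E := ℂ) 2 volume ℂ f x * monomial L (-q) x =
        ∫ x, f x * monomial L (-q) x := by
      refine integral_congr_ae ?_
      filter_upwards [ContinuousMap.coeFn_toLp (p := 2) (𝕜 := ℂ) volume f] with x hx
      rw [hx]
    rw [h1]
    field_simp

/-- Differentiate in the direction of the largest coordinate `q j`. Outside the box it dominates
every `max |q i| B`, so its `2 * n` powers can be dealt out two to each coordinate. -/
theorem norm_coeff_le_prod [hL : Fact (0 < L)] {f : Torus n L → ℂ} (hf : TorusSmooth f) {P : ℝ}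
    (hD : ∀ j x, ‖partialDeriv (2 * n) j f x‖ ≤ P ^ (2 * n)) {B : ℕ} (hB : 0 < B)
    {q : Fin n → ℤ} (hq : q ∉ box n B) :
    ‖coeff f q‖ ≤ ((L * P / (2 * Real.pi)) ^ 2) ^ n * ∏ i, 1 / (max |(q i : ℝ)| B) ^ 2 := by
  rw [mem_box, not_forall] at hq
  obtain ⟨i₀, hi₀⟩ := hq
  obtain ⟨j, -, hj⟩ := Finset.exists_max_image Finset.univ (fun i => |q i|) ⟨i₀, Finset.mem_univ _⟩
  have hBj : (B : ℤ) < |q j| := (not_le.1 hi₀).trans_le (hj i₀ (Finset.mem_univ _))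
  have hBj' : (B : ℝ) < |(q j : ℝ)| := by exact_mod_cast hBj
  have hB' : (0 : ℝ) < B := by exact_mod_cast hB
  have hqj : q j ≠ 0 := by
    rintro h
    rw [h, abs_zero] at hBj
    omega
  have hqj' : 0 < |(q j : ℝ)| := hB'.trans hBj'
  have h1 := norm_coeff_le hf (hD j) hqj
  have h2 : P ^ (2 * n) * (L / (2 * Real.pi * |(q j : ℝ)|)) ^ (2 * n) =
      ((L * P / (2 * Real.pi)) ^ 2) ^ n * ∏ _i : Fin n, 1 / |(q j : ℝ)| ^ 2 := by
    rw [Finset.prod_const, Finset.card_univ, Fintype.card_fin, ← mul_pow, ← mul_pow, pow_mul]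
    congr 1
    field_simp
  rw [h2] at h1
  refine h1.trans (mul_le_mul_of_nonneg_left ?_ (by positivity))
  refine Finset.prod_le_prod (fun i _ => by positivity) fun i _ => ?_
  have h3 : |(q i : ℝ)| ≤ |(q j : ℝ)| := by exact_mod_cast hj i (Finset.mem_univ _)
  gcongr
  exact max_le h3 hBj'.le

theorem norm_sub_sum_coeff_le [hL : Fact (0 < L)] {f : C(Torus n L, ℂ)} (hf : TorusSmooth f)
    {P : ℝ} (hD : ∀ j x, ‖partialDeriv (2 * n) j f x‖ ≤ P ^ (2 * n)) {B : ℕ} (hB : 0 < B)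
    (x : Torus n L) :
    ‖f x - ∑ q ∈ box n B, coeff f q * monomial L q x‖ ≤
      ((L * P / (2 * Real.pi)) ^ 2 * (6 / (B : ℝ))) ^ n := by
  have hsum : Summable (coeff f) := by
    refine Summable.of_norm_bounded_eventually
      ((summable_prod_inv_max_abs_sq hB).mul_left (((L * P / (2 * Real.pi)) ^ 2) ^ n)) ?_
    refine (box n B).finite_toSet.subset fun q hq => ?_
    by_contra hq'
    exact hq (norm_coeff_le_prod hf hD hB hq')
  have h1 : HasSum (fun q => coeff f q * monomial L q x) (f x) :=
    (ContinuousMap.evalCLM ℂ x).hasSum (hasSum_fourier f hsum)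
  -- It suffices to bound partial sums over finite sets containing the box, uniformly.
  refine le_of_tendsto (h1.sub_const (∑ q ∈ box n B, coeff f q * monomial L q x)).norm ?_
  refine (Filter.eventually_ge_atTop (box n B)).mono fun S hS => ?_
  rw [← Finset.sum_sdiff hS, add_sub_cancel_right, mul_pow]
  calc ‖∑ q ∈ S \ box n B, coeff f q * monomial L q x‖
      ≤ ∑ q ∈ S \ box n B, ((L * P / (2 * Real.pi)) ^ 2) ^ n *
          ∏ i, 1 / (max |(q i : ℝ)| B) ^ 2 := by
        refine norm_sum_le_of_le _ fun q hq => ?_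
        rw [norm_mul, norm_monomial_apply, mul_one]
        exact norm_coeff_le_prod hf hD hB (Finset.mem_sdiff.1 hq).2
    _ ≤ _ := by
        rw [← Finset.mul_sum]
        exact mul_le_mul_of_nonneg_left (sum_prod_inv_max_abs_sq_le hB _) (by positivity)

end Torus

/-! ### Comparison of the potential energies -/

section Quadrature

variable {n N : ℕ} {L : ℝ}

/-- The grid points of the torus. -/
def gridPoint (L : ℝ) (y : Grid n N) : Torus n L :=
  Torus.mk L fun i => ((y i : ℤ) : ℝ) * L / N

theorem monomial_gridPoint [hL : Fact (0 < L)] (q : Fin n → ℤ) (y : Grid n N) :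
    Torus.monomial L q (gridPoint L y) =
      ∏ i, Complex.exp (2 * Real.pi * Complex.I * q i * ((y i : ℤ) : ℂ) / N) := by
  have hL0 : (L : ℂ) ≠ 0 := by exact_mod_cast hL.out.ne'
  rw [gridPoint, Torus.monomial_mk]
  refine Finset.prod_congr rfl fun i _ => ?_
  congr 1
  push_cast
  field_simp

/-- The grid sees frequencies only modulo `N`; below `N` in absolute value, the only alias of zero
is zero itself. -/
theorem sum_monomial_gridPoint [Fact (0 < L)] (hN : 0 < N) (hNe : Even N) {q : Fin n → ℤ}
    (hq : ∀ i, |q i| < N) :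
    ∑ y : Grid n N, Torus.monomial L q (gridPoint L y) = if q = 0 then (N : ℂ) ^ n else 0 := by
  simp only [monomial_gridPoint]
  rw [← Fintype.prod_sum (fun (i : Fin n) (y : GridLabel N) =>
    Complex.exp (2 * Real.pi * Complex.I * q i * ((y : ℤ) : ℂ) / N))]
  simp only [sum_gridLabel_exp hN hNe]
  have h1 : ∀ i, (N : ℤ) ∣ q i ↔ q i = 0 := fun i =>
    ⟨fun h => Int.eq_zero_of_abs_lt_dvd h (hq i), fun h => h ▸ dvd_zero _⟩
  simp only [h1]
  split_ifs with h
  · simp [h]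
  · obtain ⟨i, hi⟩ := Function.ne_iff.1 h
    exact Finset.prod_eq_zero (Finset.mem_univ i) (if_neg hi)

/-- The difference between the mean over the torus and the mean over the grid. -/
def quadratureError (N : ℕ) [Fact (0 < L)] : C(Torus n L, ℂ) →ₗ[ℂ] ℂ where
  toFun f := ((L : ℂ) ^ n)⁻¹ * (∫ x, f x) - ((N : ℂ) ^ n)⁻¹ * ∑ y : Grid n N, f (gridPoint L y)
  map_add' f g := by
    simp only [ContinuousMap.add_apply]
    rw [integral_add (Torus.integrable_of_continuous f.continuous)
      (Torus.integrable_of_continuous g.continuous), Finset.sum_add_distrib]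
    ring
  map_smul' c f := by
    simp only [ContinuousMap.smul_apply, smul_eq_mul, RingHom.id_apply]
    rw [integral_const_mul, ← Finset.mul_sum]
    ring

theorem quadratureError_apply [Fact (0 < L)] (f : C(Torus n L, ℂ)) :
    quadratureError N f =
      ((L : ℂ) ^ n)⁻¹ * (∫ x, f x) - ((N : ℂ) ^ n)⁻¹ * ∑ y : Grid n N, f (gridPoint L y) := rfl

theorem quadratureError_monomial [hL : Fact (0 < L)] (hN : 0 < N) (hNe : Even N) {q : Fin n → ℤ}
    (hq : ∀ i, |q i| < N) : quadratureError N (Torus.monomial L q) = 0 := by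
  have hL0 : (L : ℂ) ^ n ≠ 0 := pow_ne_zero _ (by exact_mod_cast hL.out.ne')
  have hN0 : (N : ℂ) ^ n ≠ 0 := pow_ne_zero _ (by exact_mod_cast hN.ne')
  rw [quadratureError_apply, Torus.integral_monomial, sum_monomial_gridPoint hN hNe hq]
  split_ifs
  · rw [inv_mul_cancel₀ hL0, inv_mul_cancel₀ hN0, sub_self]
  · simp

variable {σ : Type*} [Fintype σ]

/-- Trigonometric polynomials. -/
def trigPoly (L : ℝ) (f : σ → Fin n → ℤ) (c : σ → ℂ) : C(Torus n L, ℂ) :=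
  ∑ s, c s • Torus.monomial L (f s)

theorem trigPoly_apply (f : σ → Fin n → ℤ) (c : σ → ℂ) (x : Torus n L) :
    trigPoly L f c x = ∑ s, c s * Torus.monomial L (f s) x := by
  simp [trigPoly, ContinuousMap.sum_apply]

/-- Replacing `V` by its trigonometric approximant makes the quadrature exact. The remainder, at
most `η` pointwise, is bounded separately in the two means. -/
theorem abs_mean_sub_gridMean_le [hL : Fact (0 < L)] (hN : 0 < N) (hNe : Even N)
    {f : σ → Fin n → ℤ} (hf : ∀ s i, 4 * |f s i| < N) (c : σ → ℂ) (V : C(Torus n L, ℝ))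
    {B : ℕ} (hB : 2 * B ≤ N) {a : (Fin n → ℤ) → ℂ} {η : ℝ}
    (hη : ∀ x, ‖(V x : ℂ) - ∑ q ∈ Torus.box n B, a q * Torus.monomial L q x‖ ≤ η) :
    |(L ^ n)⁻¹ * (∫ x, V x * ‖trigPoly L f c x‖ ^ 2) -
        ((N : ℝ) ^ n)⁻¹ * ∑ y : Grid n N, V (gridPoint L y) * ‖trigPoly L f c (gridPoint L y)‖ ^ 2| ≤
      η * ((L ^ n)⁻¹ * (∫ x, ‖trigPoly L f c x‖ ^ 2) +
        ((N : ℝ) ^ n)⁻¹ * ∑ y : Grid n N, ‖trigPoly L f c (gridPoint L y)‖ ^ 2) := by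
  have hLn : 0 < L ^ n := pow_pos hL.out n
  have hNn : (0 : ℝ) < (N : ℝ) ^ n := pow_pos (by exact_mod_cast hN) n
  set u := trigPoly L f c with hu
  let G : C(Torus n L, ℂ) := u * star u
  have hG : ∀ x, G x = ((‖u x‖ ^ 2 : ℝ) : ℂ) := fun x => by
    simp only [G, ContinuousMap.mul_apply, ContinuousMap.star_apply, RCLike.star_def,
      Complex.mul_conj']
    norm_cast
  let VC : C(Torus n L, ℂ) := ⟨fun x => (V x : ℂ), by fun_prop⟩
  let T : C(Torus n L, ℂ) := ∑ q ∈ Torus.box n B, a q • Torus.monomial L q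
  have hT : ∀ x, T x = ∑ q ∈ Torus.box n B, a q * Torus.monomial L q x := fun x => by
    simp [T, ContinuousMap.sum_apply]
  have hTG : T * G = ∑ q ∈ Torus.box n B, ∑ s, ∑ t, (a q * (c s * (starRingEnd ℂ) (c t))) •
      Torus.monomial L (q + (f s + -f t)) := by
    ext x
    have h1 : (T * G) x = (∑ q ∈ Torus.box n B, a q * Torus.monomial L q x) *
        ((∑ s, c s * Torus.monomial L (f s) x) *
          ∑ t, (starRingEnd ℂ) (c t) * Torus.monomial L (-f t) x) := by
      rw [ContinuousMap.mul_apply, hT]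
      simp only [G, ContinuousMap.mul_apply, ContinuousMap.star_apply, RCLike.star_def, hu,
        trigPoly_apply, map_sum, map_mul, Torus.monomial_neg]
    rw [h1, Finset.sum_mul_sum, Finset.sum_mul]
    simp only [ContinuousMap.sum_apply, ContinuousMap.smul_apply, smul_eq_mul]
    refine Finset.sum_congr rfl fun q _ => ?_
    rw [Finset.mul_sum]
    refine Finset.sum_congr rfl fun s _ => ?_
    rw [Finset.mul_sum]
    refine Finset.sum_congr rfl fun t _ => ?_
    rw [Torus.monomial_add, Torus.monomial_add]
    ring
  -- Frequencies of `T` are at most `B ≤ N / 2`, those of `G` are strictly below `N / 2`, so those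
  -- of the product stay below `N`.
  have hzero : quadratureError N (T * G) = 0 := by
    rw [hTG]
    simp only [map_sum, map_smul]
    refine Finset.sum_eq_zero fun q hq => Finset.sum_eq_zero fun s _ =>
      Finset.sum_eq_zero fun t _ => ?_
    rw [quadratureError_monomial hN hNe, smul_zero]
    intro i
    have h1 := Torus.mem_box.1 hq i
    have h2 := hf s i
    have h3 := hf t i
    simp only [Pi.add_apply, Pi.neg_apply]
    rw [abs_lt]
    rw [abs_le] at h1
    have h4 := abs_lt.1 (lt_of_mul_lt_mul_left (a := (4 : ℤ)) (b := |f s i|) (c := |f s i| + 1)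
      (by omega) (by norm_num))
    have h5 := neg_abs_le (f s i)
    have h6 := le_abs_self (f s i)
    have h7 := neg_abs_le (f t i)
    have h8 := le_abs_self (f t i)
    omega
  have hsplit : VC * G = (VC - T) * G + T * G := by ring
  have hmain : quadratureError N (VC * G) = quadratureError N ((VC - T) * G) := by
    rw [hsplit, map_add, hzero, add_zero]
  have hreal : quadratureError N (VC * G) =
      (((L ^ n)⁻¹ * (∫ x, V x * ‖u x‖ ^ 2) -
        ((N : ℝ) ^ n)⁻¹ * ∑ y : Grid n N, V (gridPoint L y) * ‖u (gridPoint L y)‖ ^ 2 : ℝ) : ℂ) := by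
    have h1 : ∀ x, (VC * G) x = ((V x * ‖u x‖ ^ 2 : ℝ) : ℂ) := fun x => by
      rw [ContinuousMap.mul_apply, hG, Complex.ofReal_mul]
      rfl
    rw [quadratureError_apply]
    simp only [h1]
    rw [integral_complex_ofReal]
    push_cast
    rfl
  have hbound : ∀ x, ‖((VC - T) * G) x‖ ≤ η * ‖u x‖ ^ 2 := fun x => by
    rw [ContinuousMap.mul_apply, norm_mul, hG, Complex.norm_real,
      Real.norm_of_nonneg (by positivity : (0 : ℝ) ≤ ‖u x‖ ^ 2), ContinuousMap.sub_apply, hT]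
    exact mul_le_mul_of_nonneg_right (hη x) (by positivity)
  have hint : Integrable fun x => η * ‖u x‖ ^ 2 :=
    Continuous.integrable_of_hasCompactSupport (by fun_prop) (HasCompactSupport.of_compactSpace _)
  rw [← Real.norm_eq_abs, ← Complex.norm_real, ← hreal, hmain, quadratureError_apply]
  refine (norm_sub_le _ _).trans ?_
  rw [norm_mul, norm_mul, norm_inv, norm_inv, norm_pow, norm_pow, Complex.norm_real,
    Real.norm_of_nonneg hL.out.le, Complex.norm_natCast, mul_add]
  have h1 : ‖∫ x, ((VC - T) * G) x‖ ≤ η * ∫ x, ‖u x‖ ^ 2 := by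
    rw [← integral_const_mul]
    exact norm_integral_le_of_norm_le hint (.of_forall hbound)
  have h2 : ‖∑ y : Grid n N, ((VC - T) * G) (gridPoint L y)‖ ≤
      η * ∑ y : Grid n N, ‖u (gridPoint L y)‖ ^ 2 := by
    rw [Finset.mul_sum]
    exact norm_sum_le_of_le _ fun y _ => hbound _
  have h3 := mul_le_mul_of_nonneg_left h1 (inv_nonneg.2 hLn.le)
  have h4 := mul_le_mul_of_nonneg_left h2 (inv_nonneg.2 hNn.le)
  linarith

theorem sum_smul_fourierBasis [Fact (0 < L)] (f : σ → Fin n → ℤ) (c : σ → ℂ) :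
    ∑ s, c s • Torus.fourierBasis n L (f s) =
      ((Torus.rootVolume n L : ℂ)⁻¹) • ContinuousMap.toLp (E := ℂ) 2 volume ℂ (trigPoly L f c) := by
  simp only [Torus.fourierBasis_apply, Torus.monomialLp, trigPoly, map_sum, map_smul,
    Finset.smul_sum]
  exact Finset.sum_congr rfl fun s _ => smul_comm _ _ _

theorem re_inner_torusPotential_trigPoly [Fact (0 < L)] (f : σ → Fin n → ℤ) (c : σ → ℂ)
    (V : C(Torus n L, ℝ)) :
    (⟪∑ s, c s • Torus.fourierBasis n L (f s),
      torusPotential V (∑ s, c s • Torus.fourierBasis n L (f s))⟫_ℂ).re =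
        (L ^ n)⁻¹ * ∫ x, V x * ‖trigPoly L f c x‖ ^ 2 := by
  rw [inner_torusPotential_self, Complex.ofReal_re, sum_smul_fourierBasis, ← integral_const_mul]
  refine integral_congr_ae ?_
  filter_upwards [Lp.coeFn_smul ((Torus.rootVolume n L : ℂ)⁻¹)
    (ContinuousMap.toLp (E := ℂ) 2 volume ℂ (trigPoly L f c)),
    ContinuousMap.coeFn_toLp (p := 2) (𝕜 := ℂ) volume (trigPoly L f c)] with x h1 h2
  rw [h1, Pi.smul_apply, h2, norm_smul, mul_pow, norm_inv, Complex.norm_real, inv_pow,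
    Real.norm_eq_abs, sq_abs, Torus.rootVolume_sq]
  ring

/-- Makes the norm identity for trigonometric polynomials the case `V = 1` of the potential form. -/
theorem torusPotential_one [Fact (0 < L)] (ψ : TorusL2 n L) :
    torusPotential (1 : C(Torus n L, ℝ)) ψ = ψ := by
  refine Lp.ext ?_
  filter_upwards [coeFn_torusPotential (1 : C(Torus n L, ℝ)) ψ] with x hx
  rw [hx]
  simp

theorem mean_norm_sq_trigPoly [Fact (0 < L)] (f : σ ↪ (Fin n → ℤ)) (c : σ → ℂ) :
    (L ^ n)⁻¹ * ∫ x, ‖trigPoly L f c x‖ ^ 2 = ∑ s, ‖c s‖ ^ 2 := by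
  have h1 := re_inner_torusPotential_trigPoly f c (1 : C(Torus n L, ℝ))
  rw [torusPotential_one, inner_self_eq_norm_sq_to_K] at h1
  simp only [ContinuousMap.one_apply, one_mul] at h1
  rw [← h1, ← norm_sq_sum_smul_embedding (Torus.fourierBasis n L) f c]
  norm_cast

theorem gridFourier_eq_monomial [Fact (0 < L)] (y k : Grid n N) :
    gridFourier n N y k = ((1 / Real.sqrt N : ℝ) : ℂ) ^ n *
      Torus.monomial L (fun i => (k i : ℤ)) (gridPoint L y) := by
  rw [monomial_gridPoint, gridFourier, Matrix.of_apply, Finset.prod_mul_distrib, Finset.prod_const,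
    Finset.card_univ, Fintype.card_fin]
  congr 1
  refine Finset.prod_congr rfl fun i _ => ?_
  congr 1
  ring

theorem norm_sq_sum_smul_gridBasis_apply [Fact (0 < L)] (hN : 0 < N) (hNe : Even N)
    (g : σ → Grid n N) (c : σ → ℂ) (y : Grid n N) :
    ‖(∑ s, c s • gridBasis hN hNe (g s)) y‖ ^ 2 =
      ((N : ℝ) ^ n)⁻¹ * ‖trigPoly L (fun s i => (g s i : ℤ)) c (gridPoint L y)‖ ^ 2 := by
  have h1 : (∑ s, c s • gridBasis hN hNe (g s)) y = ((1 / Real.sqrt N : ℝ) : ℂ) ^ n *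
      trigPoly L (fun s i => (g s i : ℤ)) c (gridPoint L y) := by
    simp only [gridBasis_apply, WithLp.ofLp_sum, Finset.sum_apply, WithLp.ofLp_smul,
      Pi.smul_apply, gridColumn, smul_eq_mul, gridFourier_eq_monomial (L := L), trigPoly_apply,
      Finset.mul_sum]
    exact Finset.sum_congr rfl fun s _ => by ring
  rw [h1, norm_mul, mul_pow, norm_pow, Complex.norm_real, ← pow_mul, mul_comm n 2, pow_mul,
    Real.norm_eq_abs, sq_abs, div_pow, Real.sq_sqrt (Nat.cast_nonneg N), one_pow, one_div, inv_pow]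

theorem re_inner_gridPotential_trigPoly [Fact (0 < L)] (hN : 0 < N) (hNe : Even N)
    (g : σ → Grid n N) (c : σ → ℂ) (V : Torus n L → ℝ) :
    (⟪∑ s, c s • gridBasis hN hNe (g s), Matrix.toEuclideanLin (gridPotential N V)
      (∑ s, c s • gridBasis hN hNe (g s))⟫_ℂ).re =
        ((N : ℝ) ^ n)⁻¹ * ∑ y : Grid n N, V (gridPoint L y) *
          ‖trigPoly L (fun s i => (g s i : ℤ)) c (gridPoint L y)‖ ^ 2 := by
  rw [inner_gridPotential_self, Complex.ofReal_re, Finset.mul_sum]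
  refine Finset.sum_congr rfl fun y _ => ?_
  rw [norm_sq_sum_smul_gridBasis_apply (L := L) hN hNe, gridPoint]
  ring

theorem gridMean_norm_sq_trigPoly [Fact (0 < L)] (hN : 0 < N) (hNe : Even N)
    (g : σ ↪ Grid n N) (c : σ → ℂ) :
    ((N : ℝ) ^ n)⁻¹ * ∑ y : Grid n N,
      ‖trigPoly L (fun s i => (g s i : ℤ)) c (gridPoint L y)‖ ^ 2 = ∑ s, ‖c s‖ ^ 2 := by
  rw [← norm_sq_sum_smul_embedding (gridBasis hN hNe) g c, EuclideanSpace.norm_sq_eq,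
    Finset.mul_sum]
  exact Finset.sum_congr rfl fun y _ => (norm_sq_sum_smul_gridBasis_apply hN hNe g c y).symm

end Quadrature

/-- The equivalence of torus and grid Hamiltonians under explicit conditions on the parameters. -/
theorem equivalentUpTo_torus_grid {n N B : ℕ} {L : ℝ} [hL : Fact (0 < L)] (hB : 0 < B)
    (hNB : N = 2 * B) {V : C(Torus n L, ℝ)} (hV : TorusSmooth V) {M P E ε : ℝ}
    (hVM : ∀ x, V x ∈ Set.Icc 0 M) (hP : ∀ j x, |partialDeriv (2 * n) j V x| ≤ P ^ (2 * n))
    (hε : 0 < ε) (hε1 : ε < 1)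
    (hη : 2 * ((L * P / (2 * Real.pi)) ^ 2 * (6 / (B : ℝ))) ^ n ≤ ε)
    (hE : 0 ≤ E → 16 * (1 + M) ^ 2 * E ≤ ε ^ 2 * (Real.pi ^ 2 * N ^ 2 / (4 * L ^ 2))) :
    EquivalentUpTo (torusSchrodinger V) (gridHamiltonian N V) E ε := by
  classical
  have hL0 := hL.out
  have hN : 0 < N := by omega
  have hN' : (0 : ℝ) < N := by exact_mod_cast hN
  have hNe : Even N := ⟨B, by omega⟩
  have hM : 0 ≤ M := (hVM (fun _ => 0)).1.trans (hVM _).2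
  have hVabs : ∀ x, |V x| ≤ M := fun x => by
    rw [abs_of_nonneg (hVM x).1]
    exact (hVM x).2
  -- The cutoff at which `eigenvalue L k < Λ` means `16 * ∑ i, k i ^ 2 < N ^ 2`. Every such label
  -- lies in the grid.
  set Λ : ℝ := Real.pi ^ 2 * N ^ 2 / (4 * L ^ 2) with hΛ
  have hΛ0 : 0 < Λ := by positivity
  have hcut : ∀ k : Fin n → ℤ, Torus.eigenvalue L k < Λ → ∀ i, 4 * |k i| < N := by
    intro k hk i
    rw [Torus.eigenvalue, hΛ, div_lt_div_iff₀ (by positivity) (by positivity)] at hk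
    have h1 : (k i : ℝ) ^ 2 ≤ ∑ i, (k i : ℝ) ^ 2 :=
      Finset.single_le_sum (f := fun i => (k i : ℝ) ^ 2) (fun _ _ => sq_nonneg _)
        (Finset.mem_univ i)
    have hpos : 0 < Real.pi ^ 2 * L ^ 2 := by positivity
    have h2 : 16 * ∑ i, (k i : ℝ) ^ 2 < (N : ℝ) ^ 2 := by
      refine lt_of_mul_lt_mul_left (a := Real.pi ^ 2 * L ^ 2) ?_ hpos.le
      linarith
    have h3 : (4 * |(k i : ℝ)|) ^ 2 < (N : ℝ) ^ 2 := by
      rw [mul_pow, sq_abs]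
      linarith
    have h4 : 4 * |(k i : ℝ)| < N := lt_of_pow_lt_pow_left₀ 2 hN'.le h3
    exact_mod_cast h4
  have hmem : ∀ k : Fin n → ℤ, Torus.eigenvalue L k < Λ → ∀ i,
      k i ∈ Finset.Ico (-((N : ℤ) / 2)) ((N : ℤ) / 2) := by
    intro k hk i
    have h1 := hcut k hk i
    have h2 := neg_abs_le (k i)
    have h3 := le_abs_self (k i)
    rw [Finset.mem_Ico]
    omega
  let σ := {k : Fin n → ℤ // Torus.eigenvalue L k < Λ}
  let fa : σ ↪ (Fin n → ℤ) := Function.Embedding.subtype _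
  let fb : σ ↪ Grid n N := ⟨fun s i => ⟨s.1 i, hmem s.1 s.2 i⟩, fun s t h => by
    refine Subtype.ext (funext fun i => ?_)
    exact congrArg Subtype.val (congrFun h i)⟩
  -- Finiteness of the retained modes comes from their embedding into the grid.
  have : Fintype σ := Fintype.ofInjective fb fb.injective
  have hVC : TorusSmooth (fun x => (V x : ℂ)) := hV.ofReal
  have happrox := Torus.norm_sub_sum_coeff_le (f := ⟨fun x => (V x : ℂ), by fun_prop⟩) hVC
    (P := P) (fun j x => by
      have h1 := partialDeriv_ofReal hV (2 * n) j x
      rw [ContinuousMap.coe_mk, h1, Complex.norm_real]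
      exact hP j x) hB
  refine equivalentUpTo_of_isDiagonalAdd (isDiagonalAdd_torusSchrodinger V)
    (isDiagonalAdd_gridHamiltonian hN hNe V) Torus.eigenvalue_nonneg
    (fun k => Torus.eigenvalue_nonneg _) hM (isSymmetric_torusPotential V)
    (inner_torusPotential_nonneg fun x => (hVM x).1) (norm_torusPotential_le hVabs)
    (isSymmetric_gridPotential V) (inner_gridPotential_nonneg fun x => (hVM x).1)
    (norm_gridPotential_le hM hVabs) hΛ0 fa fb ?_ ?_ (fun s => rfl) hε hε1 hE ?_
  · intro k
    exact ⟨fun ⟨s, hs⟩ => hs ▸ s.2, fun hk => ⟨⟨k, hk⟩, rfl⟩⟩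
  · intro k
    exact ⟨fun ⟨s, hs⟩ => hs ▸ s.2, fun hk => ⟨⟨fun i => k i, hk⟩, rfl⟩⟩
  · intro c
    rw [re_inner_torusPotential_trigPoly, re_inner_gridPotential_trigPoly]
    have h1 := abs_mean_sub_gridMean_le hN hNe (f := fa) (fun s i => hcut s.1 s.2 i) c V
      (by omega : 2 * B ≤ N) happrox
    have h2 := gridMean_norm_sq_trigPoly (L := L) hN hNe fb c
    have h3 := mean_norm_sq_trigPoly (L := L) fa c
    refine h1.trans ?_
    rw [h3]
    have h4 : ((N : ℝ) ^ n)⁻¹ * ∑ y : Grid n N, ‖trigPoly L fa c (gridPoint L y)‖ ^ 2 =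
      ∑ s, ‖c s‖ ^ 2 := h2
    rw [h4, ← two_mul, mul_left_comm, ← mul_assoc]
    exact mul_le_mul_of_nonneg_right hη (Finset.sum_nonneg fun s _ => by positivity)

end

/-! ### The choice of the constant -/

theorem mainTheorem5 :
    ∃ C : ℝ, 0 < C ∧
      ∀ (n : ℕ) (_ : 1 ≤ n) (L : ℝ) [Fact (0 < L)] (_ : 1 ≤ L)
        (V : C(Torus n L, ℝ)) (_ : TorusSmooth V)
        (Vmax : ℝ) (_ : ∀ x, V x ∈ Set.Icc 0 Vmax)
        (p : Polynomial ℝ)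
        (_ : ∀ m : ℕ, 1 ≤ m →
          0 < p.eval (m : ℝ) ∧ smoothnessFactor V m ≤ Real.log (p.eval (m : ℝ)))
        (E ε : ℝ) (_ : 1 ≤ E + Vmax) (_ : 0 < ε) (_ : ε < 1)
        (N : ℕ) (_ : ∃ q : ℕ, N = 2 ^ q)
        (_ : C * (L ^ 2 * (p.eval (2 * n : ℝ)) ^ 2 * (E + Vmax) ^ (3 / 2 : ℝ) / ε) ≤ (N : ℝ)),
        EquivalentUpTo (torusSchrodinger V) (gridHamiltonian N V) E ε := by
  -- Truncation reduces to `16 * L * w ≤ π * N * ε`, for which 8 is ample; the quadrature condition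
  -- would hold with a smaller constant.
  refine ⟨8, by norm_num, ?_⟩
  intro n hn L _ hL V hV M hVM p hp E ε hEM hε hε1 N hNq hN
  obtain ⟨hP0, hPs⟩ := hp (2 * n) (by omega)
  push_cast at hP0 hPs
  set P := p.eval (2 * n : ℝ) with hP
  have hP1 : 1 ≤ P := one_le_of_smoothnessFactor_le hP0 hPs
  set W := E + M with hW
  set w := W ^ (3 / 2 : ℝ) with hw
  have hw1 : 1 ≤ w := Real.one_le_rpow hEM (by norm_num)
  have hw2 : w ^ 2 = W ^ 3 := by
    rw [hw, ← Real.rpow_natCast, ← Real.rpow_mul (by linarith), ← Real.rpow_natCast]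
    norm_num
  have hM : 0 ≤ M := (hVM (fun _ => 0)).1.trans (hVM _).2
  have hL2 : 1 ≤ L ^ 2 := one_le_pow₀ hL
  have hP2 : 1 ≤ P ^ 2 := one_le_pow₀ hP1
  have hLP : 1 ≤ L ^ 2 * P ^ 2 := one_le_mul_of_one_le_of_one_le hL2 hP2
  rw [← mul_div_assoc, div_le_iff₀ hε] at hN
  have hN8 : (8 : ℝ) ≤ N := by
    have h1 : 1 ≤ L ^ 2 * P ^ 2 * w := one_le_mul_of_one_le_of_one_le hLP hw1
    have h2 : (N : ℝ) * ε ≤ N := mul_le_of_le_one_right (Nat.cast_nonneg N) hε1.le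
    linarith
  have hN8' : 8 ≤ N := by exact_mod_cast hN8
  -- Of the power of two only evenness is used; `N ≥ 8` excludes `2 ^ 0`.
  obtain ⟨B, hNB⟩ : ∃ B, N = 2 * B := by
    obtain ⟨q, rfl⟩ := hNq
    rcases q with _ | q
    · omega
    · exact ⟨2 ^ q, pow_succ' 2 q⟩
  have hB : 0 < B := by omega
  have hNB' : (N : ℝ) = 2 * B := by exact_mod_cast hNB
  have hB' : (0 : ℝ) < B := by exact_mod_cast hB
  have hpi := Real.pi_gt_three
  refine equivalentUpTo_torus_grid hB hNB hV hVM (P := P) (fun j x =>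
    abs_partialDeriv_le_of_smoothnessFactor_le hV hP0 hPs
      (Finset.mem_Icc.2 ⟨by omega, le_rfl⟩) j x) hε hε1 ?_ ?_
  · have h1 : (L * P / (2 * Real.pi)) ^ 2 * (6 / (B : ℝ)) ≤ ε / 2 := by
      have h2 : 8 * (L ^ 2 * P ^ 2) ≤ 2 * B * ε := by
        have : L ^ 2 * P ^ 2 ≤ L ^ 2 * P ^ 2 * w := le_mul_of_one_le_right (by positivity) hw1
        rw [hNB'] at hN
        linarith
      rw [div_pow, mul_pow, mul_pow, div_mul_div_comm, div_le_div_iff₀ (by positivity) two_pos]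
      have h3 : 9 ≤ Real.pi ^ 2 := by nlinarith
      have h4 : 9 * (B * ε) ≤ Real.pi ^ 2 * (B * ε) :=
        mul_le_mul_of_nonneg_right h3 (by positivity)
      linarith [mul_pos hB' hε]
    -- A base at most `ε / 2 < 1` only shrinks under the power `n ≥ 1`.
    have h5 : ((L * P / (2 * Real.pi)) ^ 2 * (6 / (B : ℝ))) ^ n ≤ ε / 2 := by
      refine (pow_le_pow_left₀ (by positivity) h1 n).trans ?_
      exact pow_le_of_le_one (by positivity) (by linarith) (by omega)
    linarith
  · intro hE
    have h1 : 8 * (L * w) ≤ N * ε := by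
      have h2 : L ≤ L ^ 2 * P ^ 2 := by
        calc L ≤ L ^ 2 := by nlinarith
          _ ≤ L ^ 2 * P ^ 2 := le_mul_of_one_le_right (by positivity) hP2
      have h3 : L * w ≤ L ^ 2 * P ^ 2 * w := mul_le_mul_of_nonneg_right h2 (by linarith)
      linarith
    have h4 : (8 * (L * w)) ^ 2 ≤ (N * ε) ^ 2 := pow_le_pow_left₀ (by positivity) h1 2
    have h5 : (8 * (L * w)) ^ 2 = 64 * L ^ 2 * W ^ 3 := by
      rw [← hw2]
      ring
    rw [h5] at h4
    -- For `0 ≤ E`, the quantities 1, `M` and `E` are all at most `W`. The resulting `W ^ 3` is the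
    -- square of the power 3/2 in the bound on `N`.
    have h6 : (1 + M) ^ 2 * E ≤ (2 * W) ^ 2 * W := by
      have : 1 + M ≤ 2 * W := by linarith
      have : E ≤ W := by linarith
      gcongr
    rw [← mul_div_assoc, le_div_iff₀ (by positivity)]
    have h7 : 9 ≤ Real.pi ^ 2 := by nlinarith
    calc 16 * (1 + M) ^ 2 * E * (4 * L ^ 2) = 64 * L ^ 2 * ((1 + M) ^ 2 * E) := by ring
      _ ≤ 64 * L ^ 2 * ((2 * W) ^ 2 * W) := by gcongr
      _ = 4 * (64 * L ^ 2 * W ^ 3) := by ring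
      _ ≤ 4 * (N * ε) ^ 2 := by gcongr
      _ ≤ Real.pi ^ 2 * (N * ε) ^ 2 := by gcongr; linarith
      _ = ε ^ 2 * (Real.pi ^ 2 * N ^ 2) := by ring
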